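/- Let $\mathcal P$ be the set of isomorphism classes of finite posets that contain no induced subposet isomorphic to the disjoint union of two $2$-element chains (unlabeled $(2+2)$-free posets, including the empty one). For such a $P$ the distinct strict principal down-sets $D(p)=\{q: q<p\}$, $p\in P$, form a chain $\emptyset=D_0\subset D_1\subset\dots\subset D_k$; an element $p$ has level $i$ if $D(p)=D_i$. Put $\mathrm{size}(P)=|P|$, $\mathrm{levels}(P)=k$, let $\mathrm{minmax}(P)$ be the smallest level of a maximal element, and $\min(P)$ the number of minimal elements; for the empty poset all these are $0$. The poset is decomposed by repeating the following step: choose a maximal element $m$ on the lowest possible level $i$; if $m$ is the only element on level $i$ and $i<k$, delete all relations $q<p$ with $q\in D_{i+1}\setminus D_i$; then remove $m$. Let $\mathrm{lds}(P)=0$ if $P$ is an antichain, and otherwise let $\mathrm{lds}(P)$ be the largest size of an antichain that is reached in this decomposition. Let $$G(t,u,v,z,x)=\sum_{P\in\mathcal P}t^{\mathrm{size}(P)}u^{\mathrm{levels}(P)}v^{\mathrm{minmax}(P)}z^{\min(P)}x^{\mathrm{lds}(P)} .$$ For $k\ge 1$ let $$\delta_k=u-(1-t)^k(u-1),\qquad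 \gamma_k=u-(1-zt)(1-t)^{k-1}(u-1),$$ $$\bar\delta_k=uv-(1-t)^k(uv-1),\qquad \bar\gamma_k=uv-(1-zt)(1-t)^{k-1}(uv-1),$$ and $\delta_0=\gamma_0=\bar\delta_0=\bar\gamma_0=1$. Then, in the ring $\mathbb Z[[t,u,v,z,x]]$ of formal power series, all the denominators below are invertible, both infinite series converge (coefficientwise), and $$G(t,u,v,z,x)=\frac1{1-tz}+\frac{t^2zxu}{(1-tzx)(v\delta_1-1)}\Biggl(v(v-1)+t(1-u)\bigl(z(v-1)-v\bigr)\sum_{s\ge0}\frac{u^s(1-t)^s}{\delta_s\delta_{s+1}\prod_{i=1}^{s+1}\gamma_i}+uv^3t(1-uv)\sum_{s\ge0}\frac{(uv)^s(1-t)^s}{\bar\delta_s\bar\delta_{s+1}\prod_{i=1}^{s+1}\bar\gamma_i}\Biggr).$$ Moreover $$G(t,u,v,z,x)=\sum_{w}t^{\mathrm{length}(w)}u^{\mathrm{asc}(w)}v^{\mathrm{last}(w)}z^{\mathrm{zeros}(w)}x^{\mathrm{run}(w)},$$ where $w$ runs over all ascent sequences, i.e. sequences $w=(x_1,\dots,x_n)$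 of non-negative integers, $n\ge 0$, with $x_1=0$ and $x_i\le 1+\mathrm{asc}(x_1,\dots,x_{i-1})$ for $2\le i\le n$. Here $\mathrm{asc}$ is the number of positions $j$ with $x_j<x_{j+1}$, $\mathrm{last}(w)=x_n$ ($0$ for the empty sequence), $\mathrm{zeros}(w)$ is the number of letters $0$, and $\mathrm{run}(w)$ is the number of zeros to the left of the leftmost non-zero letter ($0$ if there is no such letter). -/

import Mathlib

open scoped MvPowerSeries.WithPiTopology

noncomputable section

namespace TwoPlusTwo

/-! ### Posets without an induced `2 + 2`, and their statistics -/

/-- `P` has no induced subposet isomorphic to the disjoint union of two 2-element chains. -/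
def IsFree (P : Type*) [PartialOrder P] : Prop :=
  IsEmpty ((Fin 2 ⊕ Fin 2) ↪o P)

/-- The set `{D(x) : x ∈ P}` of all strict principal down-sets `D(x) = {y | y < x}`. -/
def downSets (P : Type*) [PartialOrder P] : Set (Set P) :=
  Set.range fun x : P => Set.Iio x

/-- The level of `x`: the index of `D(x)` in the chain `∅ = D₀ ⊂ D₁ ⊂ ⋯ ⊂ D_k` of all strict
principal down-sets, that is, the number of those properly contained in `D(x)`. -/
def level {P : Type*} [PartialOrder P] (x : P) : ℕ :=
  {D ∈ downSets P | D ⊂ Set.Iio x}.ncard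

/-- The number `k`, where `D₀ ⊂ D₁ ⊂ ⋯ ⊂ D_k` are all the strict principal down-sets
(so the trivial level `0` is not counted); it is `0` for the empty poset. -/
def levels (P : Type*) [PartialOrder P] : ℕ :=
  (downSets P).ncard - 1

/-- The least level of a maximal element; it is `0` for the empty poset. -/
def minmax (P : Type*) [PartialOrder P] : ℕ :=
  sInf (level '' {x : P | IsMax x})

/-- The number of minimal elements. -/
def minCount (P : Type*) [PartialOrder P] : ℕ :=
  {x : P | IsMin x}.ncard

/-- The down-set `D_i`, shared by all elements on level `i` (empty if there is no level `i`). -/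
def downSet (P : Type*) [PartialOrder P] (i : ℕ) : Set P :=
  {y | ∃ x : P, level x = i ∧ y < x}

/-- The set of elements that lose everything above them when the maximal element `m` is removed:
`D_{i+1} \ D_i` if `m` is alone on its level `i` and this is not the top level, and `∅` otherwise
(if `i` is the top level, then `downSet P (i + 1) = ∅`). -/
def uncovered {P : Type*} [PartialOrder P] (m : P) : Set P :=
  {y | (∀ w : P, level w = level m → w = m) ∧
    y ∈ downSet P (level m + 1) \ downSet P (level m)}

/-- One step of the decomposition: `Q` is (isomorphic to) the poset obtained from `P` by choosing
a maximal element `m` on the lowest possible level, deleting all relations `y < w` with `y` in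
`uncovered m`, and removing `m`. -/
def Removal (P Q : FinPartOrd.{0}) : Prop :=
  ∃ m : P, IsMax m ∧ level m = minmax P ∧
    ∃ e : Q ≃ {p : P // p ≠ m},
      ∀ a b : Q, a < b ↔ ((e a : P) < (e b : P) ∧ (e a : P) ∉ uncovered m)

/-- `P` is an antichain. -/
def IsAntichainPoset (P : Type*) [PartialOrder P] : Prop :=
  IsAntichain (· ≤ ·) (Set.univ : Set P)

open Classical in
/-- The largest size of an antichain that is reached when `P` is decomposed step by step;
`0` if `P` is itself an antichain. -/
def lds (P : FinPartOrd.{0}) : ℕ :=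
  if IsAntichainPoset P then 0
  else sSup {k | ∃ Q : FinPartOrd.{0}, Relation.ReflTransGen Removal P Q ∧
    IsAntichainPoset Q ∧ Nat.card Q = k}

/-- Isomorphism of finite posets. -/
def isoSetoid : Setoid FinPartOrd.{0} where
  r P Q := Nonempty (P ≃o Q)
  iseqv :=
    { refl := fun P => ⟨OrderIso.refl P⟩
      symm := fun ⟨e⟩ => ⟨e.symm⟩
      trans := fun ⟨e⟩ ⟨f⟩ => ⟨e.trans f⟩ }

/-- Unlabeled finite posets. -/
def UnlabeledPoset : Type 1 := Quotient isoSetoid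

/-- The generating function of unlabeled `(2+2)`-free posets. The variables `0, 1, 2, 3, 4` mark
the size, `levels`, `minmax`, the number of minimal elements and `lds`: the coefficient of a
monomial is the number of isomorphism classes of posets with these values of the statistics. -/
def posetGF : MvPowerSeries (Fin 5) ℤ := fun d =>
  (((fun P => (Quotient.mk isoSetoid P : UnlabeledPoset)) ''
    {P : FinPartOrd.{0} | IsFree P ∧ Nat.card P = d 0 ∧ levels P = d 1 ∧ minmax P = d 2 ∧
      minCount P = d 3 ∧ lds P = d 4}).ncard : ℤ)

/-! ### Ascent sequences and their statistics -/

/-- The number of ascents, i.e. of positions `j` with `x_j < x_{j+1}`. -/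
def asc (w : List ℕ) : ℕ :=
  (w.zip w.tail).countP fun p => p.1 < p.2

/-- `w = (x₁, …, x_n)` with `x₁ = 0` and `x_i ≤ 1 + asc (x₁, …, x_{i-1})` for `2 ≤ i ≤ n`; the
empty sequence is included. -/
def IsAscentSeq (w : List ℕ) : Prop :=
  ∀ i : ℕ, ∀ h : i < w.length, w[i] ≤ if i = 0 then 0 else 1 + asc (w.take i)

/-- The number of zeros to the left of the leftmost non-zero letter; `0` if all letters are
zero. -/
def run (w : List ℕ) : ℕ :=
  if ∀ a ∈ w, a = 0 then 0 else (w.takeWhile (· = 0)).length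

/-- The generating function of ascent sequences. The variables `0, 1, 2, 3, 4` mark the length,
the number of ascents, the last letter (`0` for the empty sequence), the number of zeros and the
initial run of zeros. -/
def ascentGF : MvPowerSeries (Fin 5) ℤ := fun d =>
  ({w : List ℕ | IsAscentSeq w ∧ w.length = d 0 ∧ asc w = d 1 ∧ w.getLastD 0 = d 2 ∧
    w.count 0 = d 3 ∧ run w = d 4}.ncard : ℤ)

/-! ### The ingredients of the formula -/

/-- `δ_k = u - (1 - t)^k (u - 1)`; in particular `δ_0 = 1`. -/
def delta {R : Type*} [CommRing R] (t u : R) (k : ℕ) : R :=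
  u - (1 - t) ^ k * (u - 1)

/-- `γ_k = u - (1 - z t) (1 - t)^{k-1} (u - 1)` for `k ≥ 1`, and `γ_0 = 1`. -/
def gamma {R : Type*} [CommRing R] (t u z : R) (k : ℕ) : R :=
  if k = 0 then 1 else u - (1 - z * t) * (1 - t) ^ (k - 1) * (u - 1)

/-- The denominator `δ_s δ_{s+1} ∏_{i=1}^{s+1} γ_i`. -/
def denom {R : Type*} [CommRing R] (t u z : R) (s : ℕ) : R :=
  delta t u s * delta t u (s + 1) * ∏ i ∈ Finset.Icc 1 (s + 1), gamma t u z i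

/-- The summand `u^s (1 - t)^s / (δ_s δ_{s+1} ∏_{i=1}^{s+1} γ_i)`. -/
def term {R : Type*} [CommRing R] (t u z : R) (s : ℕ) : R :=
  u ^ s * (1 - t) ^ s * Ring.inverse (denom t u z s)

end TwoPlusTwo

end

noncomputable section

namespace TwoPlusTwo

/-! A `(2+2)`-free poset is an interval order. Send `x` to `[ℓ x, r x]`, with `ℓ x` its level and `r
x` the last index `j` with `x ∉ D_j`; then `x < y` iff `r x < ℓ y`. Every index `0, …, k` is both a
left and a right end point, and a representation with this property is unique (`IsRep.level_eq`,
`IsRep.lastAvoid_eq`). So isomorphism classes correspond to finite multisets of intervals satisfying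
`IsCode`, plus the empty one.

On intervals, a removal step undoes `addTop i`, where `i` is the least level of a maximal element
(`IsRep.code_removal`), and `addTop i s` determines `i` and `s` (`IsCodeOrZero.addTop_injective`).
Recording the values `i` turns a poset into a word. The number of levels grows exactly when `i`
exceeds the previous value, so it is `asc`, and the bound on `i` is the one defining ascent
sequences (`IsAscentSeq.seqCode_spec`). The posets met in the decomposition belong to the prefixes
of the word; the antichains among them are the prefixes of zeros, whence `lds = run`.

For the formula, all-zero words give `1/(1 - tz)`. For the remaining words, splitting off the last
letter gives a linear equation relating `F(u,v)`, `F(u,1)` and `F(uv,1)` with kernel `v δ_1 - 1`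
(`mixedGF_functional`). The substitution `v = 1/δ_1` kills the kernel and expresses `F(u,1)` through
`F(u/δ_1,1)`. Iteration runs through the arguments `u/δ_N` (`mixedGF_iterate`); the remainder is
divisible by the `N`-th power of the variable `u`, so a series results (`mixedGF_one_eq`). Using it
at `u` and at `uv` in the equation gives the formula. -/

/-! ### Multisets of intervals encoding `(2+2)`-free posets

A nonempty `(2+2)`-free poset with levels `0, …, k` is encoded by the multiset of its intervals
`(ℓ, r)`, one for each element `x`, where `ℓ` is the level of `x` and `r` is the largest index with
`x ∉ D_r`. -/

/-- `s` is the multiset of intervals of a nonempty poset with levels `0, …, k`. -/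
structure IsCode (k : ℕ) (s : Multiset (ℕ × ℕ)) : Prop where
  fst_le_snd : ∀ p ∈ s, p.1 ≤ p.2
  snd_le : ∀ p ∈ s, p.2 ≤ k
  exists_fst : ∀ j ≤ k, ∃ p ∈ s, p.1 = j
  exists_snd : ∀ j ≤ k, ∃ p ∈ s, p.2 = j

/-- The largest right end point. -/
def topIndex (s : Multiset (ℕ × ℕ)) : ℕ := (s.map Prod.snd).sup

/-- The least left end point of an interval with the largest right end point. -/
def lowTop (s : Multiset (ℕ × ℕ)) : ℕ := sInf {a | (a, topIndex s) ∈ s}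

/-- The effect on intervals of inserting a new level `i`, when `k` is the old top level. -/
def shiftInterval (k i : ℕ) (p : ℕ × ℕ) : ℕ × ℕ :=
  if p.1 < i then (p.1, if p.2 < i then p.2 else if p.2 = k then i else p.2 + 1)
  else (p.1 + 1, p.2 + 1)

/-- Add a new maximal element on level `i`, which becomes the lowest level that contains a maximal
element. -/
def addTop (i : ℕ) (s : Multiset (ℕ × ℕ)) : Multiset (ℕ × ℕ) :=
  if i ≤ lowTop s then (i, topIndex s) ::ₘ s
  else (i, topIndex s + 1) ::ₘ s.map (shiftInterval (topIndex s) i)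

namespace IsCode

variable {k i : ℕ} {s : Multiset (ℕ × ℕ)}

theorem topIndex_eq (h : IsCode k s) : topIndex s = k := by
  apply le_antisymm
  · simp only [topIndex, Multiset.sup_le, Multiset.mem_map]
    rintro b ⟨p, hp, rfl⟩
    exact h.snd_le p hp
  · obtain ⟨p, hp, rfl⟩ := h.exists_snd k le_rfl
    exact Multiset.le_sup (Multiset.mem_map_of_mem _ hp)

theorem ne_zero (h : IsCode k s) : s ≠ 0 := by
  rintro rfl
  obtain ⟨p, hp, -⟩ := h.exists_fst 0 (Nat.zero_le _)
  simp at hp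

theorem lowTop_mem (h : IsCode k s) : (lowTop s, k) ∈ s := by
  obtain ⟨p, hp, hk⟩ := h.exists_snd k le_rfl
  have := Nat.sInf_mem (s := {a | (a, topIndex s) ∈ s})
    ⟨p.1, by rw [h.topIndex_eq, ← hk]; exact hp⟩
  rwa [Set.mem_ofPred_eq, ← lowTop, h.topIndex_eq] at this

theorem lowTop_le (h : IsCode k s) {a : ℕ} (ha : (a, k) ∈ s) : lowTop s ≤ a := by
  apply Nat.sInf_le
  rwa [Set.mem_ofPred_eq, h.topIndex_eq]

theorem lowTop_eq (h : IsCode k s) {a : ℕ} (ha : (a, k) ∈ s) (hle : ∀ b, (b, k) ∈ s → a ≤ b) :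
    lowTop s = a :=
  le_antisymm (h.lowTop_le ha) (hle _ h.lowTop_mem)

theorem lowTop_le_topIndex (h : IsCode k s) : lowTop s ≤ k :=
  h.fst_le_snd _ h.lowTop_mem

theorem addTop_of_le (h : IsCode k s) (hi : i ≤ lowTop s) : addTop i s = (i, k) ::ₘ s := by
  rw [addTop, if_pos hi, h.topIndex_eq]

theorem addTop_of_lt (h : IsCode k s) (hi : lowTop s < i) :
    addTop i s = (i, k + 1) ::ₘ s.map (shiftInterval k i) := by
  rw [addTop, if_neg hi.not_ge, h.topIndex_eq]

theorem isCode_addTop_of_le (h : IsCode k s) (hi : i ≤ lowTop s) : IsCode k (addTop i s) := by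
  rw [h.addTop_of_le hi]
  refine ⟨?_, ?_, fun j hj => ?_, fun j hj => ?_⟩
  · simpa using ⟨hi.trans h.lowTop_le_topIndex, fun a b => h.fst_le_snd (a, b)⟩
  · simpa using fun a b => h.snd_le (a, b)
  · obtain ⟨p, hp, hj⟩ := h.exists_fst j hj
    exact ⟨p, Multiset.mem_cons_of_mem hp, hj⟩
  · obtain ⟨p, hp, hj⟩ := h.exists_snd j hj
    exact ⟨p, Multiset.mem_cons_of_mem hp, hj⟩

theorem lowTop_addTop_of_le (h : IsCode k s) (hi : i ≤ lowTop s) : lowTop (addTop i s) = i := by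
  refine (h.isCode_addTop_of_le hi).lowTop_eq ?_ fun b hb => ?_ <;> rw [h.addTop_of_le hi] at *
  · exact Multiset.mem_cons_self _ _
  · rcases Multiset.mem_cons.1 hb with hb | hb
    · exact (Prod.ext_iff.1 hb).1.ge
    · exact hi.trans (h.lowTop_le hb)

theorem isCode_addTop_of_lt (h : IsCode k s) (hi : lowTop s < i) (hik : i ≤ k + 1) :
    IsCode (k + 1) (addTop i s) := by
  rw [h.addTop_of_lt hi]
  have key : ∀ p ∈ s, shiftInterval k i p ∈ (i, k + 1) ::ₘ s.map (shiftInterval k i) :=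
    fun p hp => Multiset.mem_cons_of_mem (Multiset.mem_map_of_mem _ hp)
  have hnew := Multiset.mem_cons_self (i, k + 1) (s.map (shiftInterval k i))
  refine ⟨?_, ?_, fun j hj => ?_, fun j hj => ?_⟩
  · simp only [Multiset.mem_cons, Multiset.mem_map]
    rintro _ (rfl | ⟨p, hp, rfl⟩)
    · exact hik
    · have := h.fst_le_snd p hp
      grind [shiftInterval]
  · simp only [Multiset.mem_cons, Multiset.mem_map]
    rintro _ (rfl | ⟨p, hp, rfl⟩)
    · exact le_rfl
    · have := h.snd_le p hp
      grind [shiftInterval]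
  · rcases lt_trichotomy j i with hji | rfl | hji
    · obtain ⟨p, hp, hj⟩ := h.exists_fst j (by omega)
      exact ⟨_, key p hp, by grind [shiftInterval]⟩
    · exact ⟨_, hnew, rfl⟩
    · obtain ⟨p, hp, hj⟩ := h.exists_fst (j - 1) (by omega)
      exact ⟨_, key p hp, by grind [shiftInterval]⟩
  · rcases lt_trichotomy j i with hji | rfl | hji
    · obtain ⟨p, hp, hj⟩ := h.exists_snd j (by omega)
      have := h.fst_le_snd p hp
      exact ⟨_, key p hp, by grind [shiftInterval]⟩
    · rcases hik.eq_or_lt with hk | hk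
      · exact ⟨_, hnew, hk.symm⟩
      -- For `i ≤ k` the right end point `i` comes from an old maximal element below level `i`; here
      -- `lowTop s < i` is needed.
      · exact ⟨_, key _ h.lowTop_mem, by grind [shiftInterval]⟩
    · rcases hj.eq_or_lt with hk | hk
      · exact ⟨_, hnew, hk.symm⟩
      · obtain ⟨p, hp, hj⟩ := h.exists_snd (j - 1) (by omega)
        exact ⟨_, key p hp, by grind [shiftInterval]⟩

theorem lowTop_addTop_of_lt (h : IsCode k s) (hi : lowTop s < i) (hik : i ≤ k + 1) :
    lowTop (addTop i s) = i := by
  refine (h.isCode_addTop_of_lt hi hik).lowTop_eq ?_ fun b hb => ?_ <;> rw [h.addTop_of_lt hi] at *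
  · exact Multiset.mem_cons_self _ _
  · rcases Multiset.mem_cons.1 hb with hb | hb
    · exact (Prod.ext_iff.1 hb).1.ge
    · obtain ⟨p, hp, hpb⟩ := Multiset.mem_map.1 hb
      have := h.snd_le p hp
      grind [shiftInterval]

end IsCode

/-- The shift has a left inverse `g` on intervals inside `0, …, k`: among images with left end below
`i`, the right end `i` can only come from `k`. -/
theorem map_shiftInterval_injective {k i : ℕ} {s s' : Multiset (ℕ × ℕ)}
    (hs : ∀ p ∈ s, p.1 ≤ p.2 ∧ p.2 ≤ k) (hs' : ∀ p ∈ s', p.1 ≤ p.2 ∧ p.2 ≤ k)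
    (h : s.map (shiftInterval k i) = s'.map (shiftInterval k i)) : s = s' := by
  let g : ℕ × ℕ → ℕ × ℕ := fun p =>
    if p.1 < i then (p.1, if p.2 < i then p.2 else if p.2 = i then k else p.2 - 1)
    else (p.1 - 1, p.2 - 1)
  have hg : ∀ p : ℕ × ℕ, p.1 ≤ p.2 ∧ p.2 ≤ k → g (shiftInterval k i p) = p := by
    rintro ⟨a, b⟩ hp
    simp only [g, shiftInterval]
    grind
  have hmap : ∀ s : Multiset (ℕ × ℕ), (∀ p ∈ s, p.1 ≤ p.2 ∧ p.2 ≤ k) →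
      (s.map (shiftInterval k i)).map g = s := fun s hs => by
    rw [Multiset.map_map]
    exact (Multiset.map_congr rfl fun p hp => hg p (hs p hp)).trans (Multiset.map_id' s)
  rw [← hmap s hs, ← hmap s' hs', h]

/-- `s` is the multiset of intervals of a possibly empty poset. -/
def IsCodeOrZero (s : Multiset (ℕ × ℕ)) : Prop := s = 0 ∨ ∃ k, IsCode k s

/-- The largest level on which a new maximal element can be added. -/
def levelBound (s : Multiset (ℕ × ℕ)) : ℕ := if s = 0 then 0 else topIndex s + 1

theorem topIndex_zero : topIndex 0 = 0 := rfl

/-- `sInf ∅ = 0` puts `addTop 0 0` in the branch that adds no level, so it is the one-point code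
`{(0, 0)}`. -/
theorem lowTop_zero : lowTop 0 = 0 := by simp [lowTop]

theorem isCode_addTop_zero : IsCode 0 (addTop 0 0) := by
  constructor <;> simp [addTop, topIndex_zero]

theorem card_addTop (i : ℕ) (s : Multiset (ℕ × ℕ)) :
    Multiset.card (addTop i s) = Multiset.card s + 1 := by
  unfold addTop
  split_ifs <;> simp

theorem countP_addTop (i : ℕ) (s : Multiset (ℕ × ℕ)) :
    (addTop i s).countP (fun p => p.1 = 0) =
      s.countP (fun p => p.1 = 0) + if i = 0 then 1 else 0 := by
  unfold addTop
  split_ifs with h h0 h0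
  · simp [h0]
  · simp [h0]
  · simp [h0] at h
  · rw [Multiset.countP_cons_of_neg _ (by simpa using h0), Multiset.countP_map, add_zero,
      Multiset.countP_eq_card_filter]
    congr 1
    apply Multiset.filter_congr
    intro p _
    grind [shiftInterval]

namespace IsCodeOrZero

variable {i : ℕ} {s : Multiset (ℕ × ℕ)}

theorem exists_isCode_addTop (h : IsCodeOrZero s) (hi : i ≤ levelBound s) :
    IsCode (if i ≤ lowTop s then topIndex s else topIndex s + 1) (addTop i s) := by
  rcases h with rfl | ⟨k, h⟩
  · obtain rfl : i = 0 := by simpa [levelBound] using hi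
    simpa [topIndex_zero] using isCode_addTop_zero
  · rw [levelBound, if_neg h.ne_zero, h.topIndex_eq] at hi
    rw [h.topIndex_eq]
    split_ifs with hl
    · exact h.isCode_addTop_of_le hl
    · exact h.isCode_addTop_of_lt (not_le.1 hl) hi

theorem topIndex_addTop (h : IsCodeOrZero s) (hi : i ≤ levelBound s) :
    topIndex (addTop i s) = if i ≤ lowTop s then topIndex s else topIndex s + 1 :=
  (h.exists_isCode_addTop hi).topIndex_eq

theorem lowTop_addTop (h : IsCodeOrZero s) (hi : i ≤ levelBound s) :
    lowTop (addTop i s) = i := by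
  rcases h with rfl | ⟨k, h⟩
  · obtain rfl : i = 0 := by simpa [levelBound] using hi
    exact Nat.le_zero.1 isCode_addTop_zero.lowTop_le_topIndex
  · rw [levelBound, if_neg h.ne_zero, h.topIndex_eq] at hi
    rcases le_or_gt i (lowTop s) with hl | hl
    · exact h.lowTop_addTop_of_le hl
    · exact h.lowTop_addTop_of_lt hl hi

/-- The index `i` is recovered as `lowTop`. The branch used is visible from the number of intervals
with left end `i`: at least two if the level existed already, exactly one if it was inserted. -/
theorem addTop_injective {s' : Multiset (ℕ × ℕ)} {i' : ℕ} (h : IsCodeOrZero s)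
    (h' : IsCodeOrZero s') (hi : i ≤ levelBound s) (hi' : i' ≤ levelBound s')
    (heq : addTop i s = addTop i' s') : i = i' ∧ s = s' := by
  obtain rfl : i = i' := by rw [← h.lowTop_addTop hi, heq, h'.lowTop_addTop hi']
  refine ⟨rfl, ?_⟩
  have hcard : Multiset.card s = Multiset.card s' := by
    simpa [card_addTop] using congrArg Multiset.card heq
  have htop := congrArg topIndex heq
  rw [h.topIndex_addTop hi, h'.topIndex_addTop hi'] at htop
  rcases h with rfl | ⟨k, h⟩
  · exact (Multiset.card_eq_zero.1 (by simpa using hcard.symm)).symm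
  rcases h' with rfl | ⟨k', h'⟩
  · exact Multiset.card_eq_zero.1 (by simpa using hcard)
  have hle : ∀ {k : ℕ} {s : Multiset (ℕ × ℕ)}, IsCode k s → i ≤ lowTop s →
      2 ≤ (addTop i s).countP (fun p => p.1 = i) := by
    intro k s h hl
    obtain ⟨p, hp, hpi⟩ := h.exists_fst i (hl.trans h.lowTop_le_topIndex)
    rw [h.addTop_of_le hl, Multiset.countP_cons_of_pos (p := fun p : ℕ × ℕ => p.1 = i) _ rfl]
    have := (Multiset.countP_pos (p := fun p : ℕ × ℕ => p.1 = i)).2 ⟨p, hp, hpi⟩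
    omega
  have hlt : ∀ {k : ℕ} {s : Multiset (ℕ × ℕ)}, IsCode k s → lowTop s < i →
      (addTop i s).countP (fun p => p.1 = i) = 1 := by
    intro k s h hl
    rw [h.addTop_of_lt hl, Multiset.countP_cons_of_pos (p := fun p : ℕ × ℕ => p.1 = i) _ rfl,
      Nat.add_eq_right, Multiset.countP_eq_zero]
    intro q hq
    obtain ⟨p, -, rfl⟩ := Multiset.mem_map.1 hq
    grind [shiftInterval]
  rw [h.topIndex_eq, h'.topIndex_eq] at htop
  rcases le_or_gt i (lowTop s) with hl | hl <;> rcases le_or_gt i (lowTop s') with hl' | hl'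
  · rw [if_pos hl, if_pos hl'] at htop
    subst htop
    rwa [h.addTop_of_le hl, h'.addTop_of_le hl', Multiset.cons_inj_right] at heq
  · have := hle h hl
    rw [heq, hlt h' hl'] at this
    omega
  · have := hle h' hl'
    rw [← heq, hlt h hl] at this
    omega
  · rw [if_neg hl.not_ge, if_neg hl'.not_ge, Nat.add_right_cancel_iff] at htop
    subst htop
    rw [h.addTop_of_lt hl, h'.addTop_of_lt hl', Multiset.cons_inj_right] at heq
    exact map_shiftInterval_injective (fun p hp => ⟨h.fst_le_snd p hp, h.snd_le p hp⟩)
      (fun p hp => ⟨h'.fst_le_snd p hp, h'.snd_le p hp⟩) heq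

end IsCodeOrZero

/-! ### The intervals of a `(2+2)`-free poset -/

/-- The largest index `j` with `x ∉ D_j`. -/
def lastAvoid {P : Type*} [PartialOrder P] (x : P) : ℕ :=
  {D ∈ downSets P | x ∉ D}.ncard - 1

/-- The functions `ℓ` and `r` represent `P` by intervals with end points in `0, …, k`, such that
each of these numbers is a left and a right end point. -/
structure IsRep (P : Type*) [PartialOrder P] (k : ℕ) (ℓ r : P → ℕ) : Prop where
  lt_iff : ∀ x y, x < y ↔ r x < ℓ y
  le_top : ∀ x, r x ≤ k
  exists_left : ∀ j ≤ k, ∃ x, ℓ x = j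
  exists_right : ∀ j ≤ k, ∃ x, r x = j

namespace IsRep

variable {P : Type*} [PartialOrder P] {k : ℕ} {ℓ r : P → ℕ}

theorem left_le_right (h : IsRep P k ℓ r) (x : P) : ℓ x ≤ r x :=
  not_lt.1 fun hx => lt_irrefl x ((h.lt_iff x x).2 hx)

theorem left_le_top (h : IsRep P k ℓ r) (x : P) : ℓ x ≤ k :=
  (h.left_le_right x).trans (h.le_top x)

theorem isMax_iff (h : IsRep P k ℓ r) (x : P) : IsMax x ↔ r x = k := by
  rw [isMax_iff_forall_not_lt]
  refine ⟨fun hx => le_antisymm (h.le_top x) ?_, fun hx y hxy => ?_⟩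
  · obtain ⟨y, hy⟩ := h.exists_left k le_rfl
    have := hx y
    rw [h.lt_iff] at this
    omega
  · have := (h.lt_iff x y).1 hxy
    have := h.left_le_top y
    omega

theorem isMin_iff (h : IsRep P k ℓ r) (x : P) : IsMin x ↔ ℓ x = 0 := by
  rw [isMin_iff_forall_not_lt]
  refine ⟨fun hx => ?_, fun hx y hxy => ?_⟩
  · obtain ⟨y, hy⟩ := h.exists_right 0 (Nat.zero_le _)
    have := hx y
    rw [h.lt_iff] at this
    omega
  · have := (h.lt_iff y x).1 hxy
    omega

theorem isFree (h : IsRep P k ℓ r) : IsFree P := by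
  refine ⟨fun f => ?_⟩
  have h1 := (h.lt_iff _ _).1 (f.lt_iff_lt.2 (Sum.inl_lt_inl_iff.2 (show (0 : Fin 2) < 1 by simp)))
  have h2 := (h.lt_iff _ _).1 (f.lt_iff_lt.2 (Sum.inr_lt_inr_iff.2 (show (0 : Fin 2) < 1 by simp)))
  have h3 := mt (h.lt_iff _ _).2 (mt f.lt_iff_lt.1
    (Sum.not_inl_lt_inr (a := (1 : Fin 2)) (b := (0 : Fin 2))))
  have h4 := mt (h.lt_iff _ _).2 (mt f.lt_iff_lt.1
    (Sum.not_inr_lt_inl (a := (1 : Fin 2)) (b := (0 : Fin 2))))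
  omega

/-- The down-set `D_j` of a represented poset. -/
theorem Iio_eq (h : IsRep P k ℓ r) (x : P) : Set.Iio x = {y | r y < ℓ x} :=
  Set.ext fun y => h.lt_iff y x

theorem subset_iff (h : IsRep P k ℓ r) {i j : ℕ} (hi : i ≤ k) :
    {y | r y < i} ⊆ {y | r y < j} ↔ i ≤ j := by
  refine ⟨fun hs => not_lt.1 fun hji => ?_, fun hij y hy => lt_of_lt_of_le hy hij⟩
  obtain ⟨y, hy⟩ := h.exists_right j (by omega)
  have : y ∈ {y | r y < j} := hs (show r y < i by omega)
  exact absurd this (by simp [hy])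

theorem downSets_eq (h : IsRep P k ℓ r) :
    downSets P = (fun j => {y | r y < j}) '' Set.Iic k := by
  ext D
  constructor
  · rintro ⟨x, rfl⟩
    exact ⟨ℓ x, h.left_le_top x, (h.Iio_eq x).symm⟩
  · rintro ⟨j, hj, rfl⟩
    obtain ⟨x, rfl⟩ := h.exists_left j hj
    exact ⟨x, h.Iio_eq x⟩

theorem injOn (h : IsRep P k ℓ r) : Set.InjOn (fun j => {y | r y < j}) (Set.Iic k) :=
  fun _ hi _ hj hij => le_antisymm ((h.subset_iff hi).1 hij.le) ((h.subset_iff hj).1 hij.ge)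

theorem ncard_sep (h : IsRep P k ℓ r) (p : Set P → Prop) :
    {D ∈ downSets P | p D}.ncard = {j | j ≤ k ∧ p {y | r y < j}}.ncard := by
  rw [← Set.InjOn.ncard_image (h.injOn.mono (s₁ := {j | j ≤ k ∧ p {y | r y < j}})
    fun j hj => hj.1), h.downSets_eq]
  congr 1
  ext D
  constructor
  · rintro ⟨⟨j, hj, rfl⟩, hD⟩
    exact ⟨j, ⟨hj, hD⟩, rfl⟩
  · rintro ⟨j, ⟨hj, hD⟩, rfl⟩
    exact ⟨⟨j, hj, rfl⟩, hD⟩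

/-- The sets `{y | r y < j}` with `j ≤ k` are distinct and are all the down-sets, so `ℓ x` of them
lie strictly inside `D(x)`. Hence levels may be read off from any representation, which is how codes
are computed below. -/
theorem level_eq (h : IsRep P k ℓ r) (x : P) : level x = ℓ x := by
  rw [level, h.ncard_sep, h.Iio_eq]
  have : {j | j ≤ k ∧ {y | r y < j} ⊂ {y | r y < ℓ x}} = Set.Iio (ℓ x) := by
    ext j
    have hx := h.left_le_top x
    constructor
    · rintro ⟨hj, hs⟩
      exact not_le.1 fun hle => hs.2 ((h.subset_iff hx).2 hle)
    · intro hj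
      have hj' : j < ℓ x := hj
      exact ⟨by omega, (h.subset_iff (by omega)).2 hj'.le,
        fun hs => absurd ((h.subset_iff hx).1 hs) hj'.not_ge⟩
  rw [this]
  simp

theorem lastAvoid_eq (h : IsRep P k ℓ r) (x : P) : lastAvoid x = r x := by
  rw [lastAvoid, h.ncard_sep]
  have : {j | j ≤ k ∧ x ∉ {y | r y < j}} = Set.Iic (r x) := by
    ext j
    have := h.le_top x
    simp only [Set.mem_ofPred_eq, not_lt, Set.mem_Iic]
    omega
  rw [this]
  simp

theorem mem_downSet (h : IsRep P k ℓ r) (j : ℕ) (y : P) :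
    y ∈ downSet P j ↔ j ≤ k ∧ r y < j := by
  simp only [downSet, Set.mem_ofPred_eq, h.level_eq, h.lt_iff]
  constructor
  · rintro ⟨x, rfl, hy⟩
    exact ⟨h.left_le_top x, hy⟩
  · rintro ⟨hj, hy⟩
    obtain ⟨x, rfl⟩ := h.exists_left j hj
    exact ⟨x, rfl, hy⟩

theorem mem_uncovered (h : IsRep P k ℓ r) (m y : P) :
    y ∈ uncovered m ↔ (∀ w, ℓ w = ℓ m → w = m) ∧ ℓ m < k ∧ r y = ℓ m := by
  simp only [uncovered, Set.mem_ofPred_eq, Set.mem_sdiff, h.mem_downSet, h.level_eq]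
  have := h.left_le_top m
  refine and_congr_right fun _ => ?_
  omega

end IsRep

section Free

variable {P : Type*} [PartialOrder P]

/-- If `a ∈ D(x) \ D(y)` and `b ∈ D(y) \ D(x)`, then `a < x` and `b < y` form an induced `2 + 2`. -/
theorem IsFree.subset_or_subset (h : IsFree P) (x y : P) :
    Set.Iio x ⊆ Set.Iio y ∨ Set.Iio y ⊆ Set.Iio x := by
  by_contra! hxy
  obtain ⟨⟨a, hax, hay⟩, ⟨b, hby, hbx⟩⟩ := hxy.imp Set.not_subset.1 Set.not_subset.1
  simp only [Set.mem_Iio] at hax hay hby hbx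
  have h1 : ¬ a ≤ b := fun h => hay (h.trans_lt hby)
  have h2 : ¬ a ≤ y := fun h => h.lt_or_eq.elim hay fun h => hbx (hby.trans (h ▸ hax))
  have h3 : ¬ x ≤ b := fun h => hay (hax.trans (h.trans_lt hby))
  have h4 : ¬ x ≤ y := fun h => hay (hax.trans_le h)
  have h5 : ¬ b ≤ a := fun h => hbx (h.trans_lt hax)
  have h6 : ¬ b ≤ x := fun h => h.lt_or_eq.elim hbx fun h => hay (hax.trans (h ▸ hby))
  have h7 : ¬ y ≤ a := fun h => hbx (hby.trans (h.trans_lt hax))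
  have h8 : ¬ y ≤ x := fun h => hbx (hby.trans_le h)
  refine h.false (OrderEmbedding.ofMapLEIff (Sum.elim ![a, x] ![b, y]) ?_)
  rintro (i | i) (j | j) <;> fin_cases i <;> fin_cases j <;>
    simp [h1, h2, h3, h4, h5, h6, h7, h8, hax.le, hby.le, hax.not_ge, hby.not_ge]

variable [Finite P]

/-- If `x < y`, every down-set avoiding `x` lies strictly inside `D(y)`, because down-sets form a
chain. If not, those strictly inside `D(y)` avoid `x`, and so does `D(y)` itself. The `- 1` in
`lastAvoid` is harmless because `∅` is a down-set. -/
theorem IsFree.lt_iff [Nonempty P] (h : IsFree P) (x y : P) : x < y ↔ lastAvoid x < level y := by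
  have hfin : ∀ p : Set P → Prop, {D ∈ downSets P | p D}.Finite := fun p => Set.toFinite _
  have hpos : 0 < {D ∈ downSets P | x ∉ D}.ncard := by
    obtain ⟨a, ha⟩ := (Set.toFinite (Set.univ : Set P)).exists_minimal Set.univ_nonempty
    refine (Set.ncard_pos (hfin _)).2 ⟨Set.Iio a, ⟨a, rfl⟩, fun hx => ?_⟩
    exact (lt_irrefl x) (lt_of_lt_of_le hx (ha.2 trivial hx.le))
  unfold lastAvoid level
  constructor
  · intro hxy
    have : {D ∈ downSets P | x ∉ D}.ncard ≤ {D ∈ downSets P | D ⊂ Set.Iio y}.ncard := by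
      refine Set.ncard_le_ncard ?_ (hfin _)
      rintro _ ⟨⟨w, rfl⟩, hw⟩
      have hyw : ¬ Set.Iio y ⊆ Set.Iio w := fun hs => hw (hs hxy)
      exact ⟨⟨w, rfl⟩, (h.subset_or_subset w y).resolve_right hyw, hyw⟩
    omega
  · intro hlt
    by_contra hxy
    have : {D ∈ downSets P | D ⊂ Set.Iio y}.ncard < {D ∈ downSets P | x ∉ D}.ncard := by
      refine Set.ncard_lt_ncard ?_ (hfin _)
      refine ⟨fun D hD => ⟨hD.1, fun hx => hxy (hD.2.1 hx)⟩, fun hs => ?_⟩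
      have := hs (a := Set.Iio y) ⟨⟨y, rfl⟩, hxy⟩
      exact this.2.2 subset_rfl
    omega

/-- Pigeonhole: on the chain of down-sets, the number of smaller members is injective and less than
the length of the chain, so all values occur. -/
theorem IsFree.exists_level_eq [Nonempty P] (h : IsFree P) {j : ℕ} (hj : j ≤ levels P) :
    ∃ x : P, level x = j := by
  have hfin : (downSets P).Finite := Set.toFinite _
  have hpos : 0 < (downSets P).ncard := (Set.ncard_pos hfin).2 (Set.range_nonempty _)
  have hmono : ∀ x y : P, Set.Iio x ⊂ Set.Iio y → level x < level y := fun x y hxy => by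
    refine Set.ncard_lt_ncard ⟨fun D hD => ⟨hD.1, hD.2.trans hxy⟩, fun hs => ?_⟩ (Set.toFinite _)
    exact (hs (a := Set.Iio x) ⟨⟨x, rfl⟩, hxy⟩).2.2 subset_rfl
  let f : Set P → ℕ := fun D => {D' ∈ downSets P | D' ⊂ D}.ncard
  have hinj : Set.InjOn f (downSets P) := by
    rintro _ ⟨x, rfl⟩ _ ⟨y, rfl⟩ hxy
    change level x = level y at hxy
    by_contra hne
    rcases h.subset_or_subset x y with hs | hs
    · exact (hmono x y (hs.ssubset_of_ne hne)).ne hxy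
    · exact (hmono y x (hs.ssubset_of_ne (Ne.symm hne))).ne hxy.symm
  have himage : f '' downSets P ⊆ Set.Iio (downSets P).ncard := by
    rintro _ ⟨D, hD, rfl⟩
    exact Set.ncard_lt_ncard ⟨fun D' hD' => hD'.1, fun hs => (hs hD).2.2 subset_rfl⟩ hfin
  have heq := Set.eq_of_subset_of_ncard_le himage
    (by rw [hinj.ncard_image]; simp) (Set.toFinite _)
  have hmem : j ∈ f '' downSets P := by
    rw [heq, Set.mem_Iio]
    unfold levels at hj
    omega
  obtain ⟨_, ⟨x, rfl⟩, hx⟩ := hmem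
  exact ⟨x, hx⟩

theorem IsFree.isRep [Nonempty P] (h : IsFree P) :
    IsRep P (levels P) (level (P := P)) (lastAvoid (P := P)) where
  lt_iff := h.lt_iff
  le_top x := by
    have := Set.ncard_le_ncard (s := {D ∈ downSets P | x ∉ D}) (t := downSets P)
      (fun D hD => hD.1) (Set.toFinite _)
    unfold lastAvoid levels
    omega
  exists_left j hj := h.exists_level_eq hj
  exists_right j hj := by
    rcases hj.eq_or_lt with rfl | hj
    · obtain ⟨x, hx⟩ := (Set.toFinite (Set.univ : Set P)).exists_maximal Set.univ_nonempty
      refine ⟨x, ?_⟩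
      have : {D ∈ downSets P | x ∉ D} = downSets P := by
        refine Set.sep_eq_self_iff_mem_true.2 ?_
        rintro _ ⟨w, rfl⟩ hxw
        exact lt_irrefl x (lt_of_lt_of_le hxw (hx.2 trivial (le_of_lt hxw)))
      rw [lastAvoid, this, levels]
    -- For `j < k`, any element of `D_{j+1} \ D_j` has right end `j`.
    · obtain ⟨y, hy⟩ := h.exists_level_eq hj.le
      obtain ⟨y', hy'⟩ := h.exists_level_eq (j := j + 1) hj
      have hs : ¬ Set.Iio y' ⊆ Set.Iio y := fun hs => by
        have : level y' ≤ level y :=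
          Set.ncard_le_ncard (fun D hD => ⟨hD.1, hD.2.trans_subset hs⟩) (Set.toFinite _)
        omega
      obtain ⟨x, hx', hx⟩ := Set.not_subset.1 hs
      refine ⟨x, ?_⟩
      have h1 := (h.lt_iff x y').1 hx'
      have h2 := mt (h.lt_iff x y).2 hx
      omega

end Free

/-! ### Unlabeled `(2+2)`-free posets are determined by their intervals -/

/-- The multiset of the intervals of the elements of `P`. -/
def code (P : Type*) [PartialOrder P] [Fintype P] : Multiset (ℕ × ℕ) :=
  (Finset.univ : Finset P).val.map fun x => (level x, lastAvoid x)

section Code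

variable {P Q : Type*} [PartialOrder P] [PartialOrder Q] [Fintype P] [Fintype Q]

theorem IsRep.code_eq {k : ℕ} {ℓ r : P → ℕ} (h : IsRep P k ℓ r) :
    code P = (Finset.univ : Finset P).val.map fun x => (ℓ x, r x) := by
  simp only [code, h.level_eq, h.lastAvoid_eq]

theorem IsRep.mem_code {k : ℕ} {ℓ r : P → ℕ} (h : IsRep P k ℓ r) {p : ℕ × ℕ} :
    p ∈ code P ↔ ∃ x, (ℓ x, r x) = p := by
  simp [h.code_eq]

theorem IsRep.isCode {k : ℕ} {ℓ r : P → ℕ} (h : IsRep P k ℓ r) : IsCode k (code P) := by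
  refine ⟨fun p hp => ?_, fun p hp => ?_, fun j hj => ?_, fun j hj => ?_⟩
  · obtain ⟨x, rfl⟩ := h.mem_code.1 hp
    exact h.left_le_right x
  · obtain ⟨x, rfl⟩ := h.mem_code.1 hp
    exact h.le_top x
  · obtain ⟨x, hx⟩ := h.exists_left j hj
    exact ⟨_, h.mem_code.2 ⟨x, rfl⟩, hx⟩
  · obtain ⟨x, hx⟩ := h.exists_right j hj
    exact ⟨_, h.mem_code.2 ⟨x, rfl⟩, hx⟩

theorem card_code : Multiset.card (code P) = Nat.card P := by
  simp [code]

theorem code_eq_zero [IsEmpty P] : code P = 0 := by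
  simp [code]

theorem IsFree.isCodeOrZero (h : IsFree P) : IsCodeOrZero (code P) := by
  cases isEmpty_or_nonempty P
  · exact Or.inl code_eq_zero
  · exact Or.inr ⟨_, h.isRep.isCode⟩

theorem IsFree.topIndex_code (h : IsFree P) : topIndex (code P) = levels P := by
  cases isEmpty_or_nonempty P
  · rw [code_eq_zero, topIndex_zero]
    rw [levels, downSets, Set.range_eq_empty, Set.ncard_empty]
  · exact h.isRep.isCode.topIndex_eq

theorem IsFree.lowTop_code (h : IsFree P) : lowTop (code P) = minmax P := by
  cases isEmpty_or_nonempty P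
  · rw [code_eq_zero, lowTop_zero, minmax, Set.eq_empty_of_isEmpty {x : P | IsMax x}]
    simp
  · rw [lowTop, minmax, h.topIndex_code]
    congr 1
    ext a
    simp [h.isRep.mem_code, h.isRep.isMax_iff, and_comm]

theorem IsFree.countP_code (h : IsFree P) :
    (code P).countP (fun p => p.1 = 0) = minCount P := by
  cases isEmpty_or_nonempty P
  · rw [code_eq_zero, minCount, Set.eq_empty_of_isEmpty {x : P | IsMin x}]
    simp
  · classical
    rw [minCount, code, Multiset.countP_map, Set.ncard_eq_toFinset_card']
    simp only [h.isRep.isMin_iff, Set.toFinset_ofPred]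
    rfl

/-- The fibres of `f` and `g` have equal cardinalities, so bijections between them glue. -/
theorem exists_equiv_of_map_univ_eq {α β γ : Type*} [Fintype α] [Fintype β] {f : α → γ}
    {g : β → γ} (h : (Finset.univ : Finset α).val.map f = (Finset.univ : Finset β).val.map g) :
    ∃ e : α ≃ β, ∀ x, g (e x) = f x := by
  classical
  have hcard : ∀ c, Fintype.card {a // f a = c} = Fintype.card {b // g b = c} := fun c => by
    have := congrArg (Multiset.count c) h
    rw [Multiset.count_map, Multiset.count_map] at this
    rw [Fintype.card_subtype, Fintype.card_subtype]
    simpa [Finset.card, eq_comm] using this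
  exact ⟨Equiv.ofFiberEquiv fun c => Fintype.equivOfCardEq (hcard c),
    fun x => Equiv.ofFiberEquiv_map _ x⟩

theorem nonempty_orderIso_of_code_eq (hP : IsFree P) (hQ : IsFree Q) (h : code P = code Q) :
    Nonempty (P ≃o Q) := by
  obtain ⟨e, he⟩ := exists_equiv_of_map_univ_eq h
  simp only [Prod.mk.injEq] at he
  have hlt : ∀ x y, e x < e y ↔ x < y := fun x y => by
    have : Nonempty P := ⟨x⟩
    have : Nonempty Q := ⟨e x⟩
    rw [hP.lt_iff, hQ.lt_iff, (he x).2, (he y).1]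
  refine ⟨⟨e, fun {x y} => ?_⟩⟩
  rw [le_iff_lt_or_eq, le_iff_lt_or_eq, hlt, e.injective.eq_iff]

theorem IsFree.code_congr (e : P ≃o Q) (h : IsFree P) : code P = code Q := by
  cases isEmpty_or_nonempty P
  · have := e.symm.toEquiv.isEmpty
    rw [code_eq_zero, code_eq_zero]
  · have hrep : IsRep Q (levels P) (fun y => level (e.symm y)) (fun y => lastAvoid (e.symm y)) := by
      refine ⟨fun x y => ?_, fun x => h.isRep.le_top _, fun j hj => ?_, fun j hj => ?_⟩
      · rw [← h.lt_iff, e.symm.lt_iff_lt]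
      · obtain ⟨x, hx⟩ := h.isRep.exists_left j hj
        exact ⟨e x, by simpa using hx⟩
      · obtain ⟨x, hx⟩ := h.isRep.exists_right j hj
        exact ⟨e x, by simpa using hx⟩
    rw [hrep.code_eq, code, ← Finset.map_univ_equiv e.toEquiv, Finset.map_val, Multiset.map_map]
    simp

end Code

/-- The partial order on a type of intervals, in which an interval is smaller than another one if
it lies entirely to its left. -/
abbrev intervalOrder {α : Type*} (f : α → ℕ × ℕ) (hf : ∀ a, (f a).1 ≤ (f a).2) :
    PartialOrder α where
  le a b := a = b ∨ (f a).2 < (f b).1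
  le_refl a := Or.inl rfl
  le_trans a b c := by
    rintro (rfl | hab) (rfl | hbc)
    · exact Or.inl rfl
    · exact Or.inr hbc
    · exact Or.inr hab
    · exact Or.inr (hab.trans_le ((hf b).trans hbc.le))
  le_antisymm a b := by
    rintro (rfl | hab) (h | hba)
    · rfl
    · rfl
    · exact h.symm
    · have := hf a
      have := hf b
      omega

/-- The carrier `s.ToType` has one point for each occurrence in `s`, so repeated intervals become
distinct elements. -/
theorem IsCode.exists_poset {k : ℕ} {s : Multiset (ℕ × ℕ)} (h : IsCode k s) :
    ∃ P : FinPartOrd.{0}, IsFree P ∧ code P = s := by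
  let _ : PartialOrder s.ToType := intervalOrder (fun a => a.1)
    fun a => h.fst_le_snd _ (Multiset.coe_mem (x := a))
  have hrep : IsRep s.ToType k (fun a => a.1.1) (fun a => a.1.2) := by
    refine ⟨fun a b => ?_, fun a => h.snd_le _ Multiset.coe_mem, fun j hj => ?_, fun j hj => ?_⟩
    · have ha := h.fst_le_snd _ (Multiset.coe_mem (x := a))
      have hb := h.fst_le_snd _ (Multiset.coe_mem (x := b))
      refine ⟨fun hab => hab.le.resolve_left hab.ne, fun hab => ⟨Or.inr hab, ?_⟩⟩
      rintro (rfl | hba)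
      · exact absurd hab ha.not_gt
      · exact absurd (hab.trans_le (hb.trans hba.le)) ha.not_gt
    · obtain ⟨p, hp, rfl⟩ := h.exists_fst j hj
      exact ⟨⟨p, ⟨0, Multiset.count_pos.2 hp⟩⟩, rfl⟩
    · obtain ⟨p, hp, rfl⟩ := h.exists_snd j hj
      exact ⟨⟨p, ⟨0, Multiset.count_pos.2 hp⟩⟩, rfl⟩
  refine ⟨FinPartOrd.of s.ToType, hrep.isFree, ?_⟩
  exact hrep.code_eq.trans s.map_univ_coe

theorem IsCodeOrZero.exists_poset {s : Multiset (ℕ × ℕ)} (h : IsCodeOrZero s) :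
    ∃ P : FinPartOrd.{0}, IsFree P ∧ code P = s := by
  rcases h with rfl | ⟨k, h⟩
  · exact ⟨FinPartOrd.of PEmpty, ⟨fun f => (f (Sum.inl 0)).elim⟩, code_eq_zero⟩
  · exact h.exists_poset

/-! ### The decomposition in terms of intervals -/

/-- Transitivity survives the deletion of relations because only the lower element of a pair is
tested for membership in `uncovered m`. -/
theorem exists_removal (P : FinPartOrd.{0}) [Nonempty P] : ∃ Q, Removal P Q := by
  classical
  obtain ⟨m, hm, hlevel⟩ : minmax P ∈ level '' {x : P | IsMax x} := by
    obtain ⟨x, hx⟩ := (Set.toFinite (Set.univ : Set P)).exists_maximal Set.univ_nonempty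
    exact Nat.sInf_mem ⟨_, x, fun y hy => hx.2 trivial hy, rfl⟩
  let order : PartialOrder {p : P // p ≠ m} :=
    { le := fun a b => a = b ∨ ((a : P) < b ∧ (a : P) ∉ uncovered m)
      lt := fun a b => (a : P) < b ∧ (a : P) ∉ uncovered m
      le_refl := fun a => Or.inl rfl
      le_trans := by
        rintro a b c (rfl | hab) (rfl | hbc)
        · exact Or.inl rfl
        · exact Or.inr hbc
        · exact Or.inr hab
        · exact Or.inr ⟨hab.1.trans hbc.1, hab.2⟩
      lt_iff_le_not_ge := fun a b => by
        refine ⟨fun hab => ⟨Or.inr hab, ?_⟩, fun hab => hab.1.resolve_left ?_⟩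
        · rintro (rfl | hba)
          · exact hab.1.false
          · exact hab.1.asymm hba.1
        · rintro rfl
          exact hab.2 (Or.inl rfl)
      le_antisymm := by
        rintro a b (rfl | hab) (h | hba)
        · rfl
        · rfl
        · exact h.symm
        · exact absurd hba.1 hab.1.asymm }
  exact ⟨@FinPartOrd.of _ order _, m, hm, hlevel, Equiv.refl _, fun a b => Iff.rfl⟩

theorem map_univ_eq_cons {P Q γ : Type*} [Fintype P] [Fintype Q] {m : P} {g : Q → P}
    (hg : Function.Injective g)
    (hm : ∀ p, p ≠ m ↔ ∃ q, g q = p) (f : P → γ) :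
    (Finset.univ : Finset P).val.map f =
      f m ::ₘ (Finset.univ : Finset Q).val.map fun q => f (g q) := by
  classical
  have h : (Finset.univ : Finset P).erase m = Finset.univ.map ⟨g, hg⟩ := by
    ext p
    simp [hm]
  have hv : (Finset.univ : Finset P).val = m ::ₘ (Finset.univ.erase m : Finset P).val := by
    rw [Finset.erase_val, Multiset.cons_erase (Finset.mem_univ m)]
  rw [hv, h, Finset.map_val, Multiset.map_cons, Multiset.map_map]
  rfl

section Removal

variable {P Q : Type*} [PartialOrder P] [PartialOrder Q] [Fintype P] [Fintype Q]
  {k : ℕ} {ℓ r : P → ℕ} {m : P} {g : Q → P}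

/-- If `m` shares its level, the other intervals are unchanged. If `m` is alone on the top level, it
is the only maximal element and level `k` vanishes. If `m` is alone on a lower level, that level
vanishes and the elements with right end `ℓ m` become maximal. The old maximal elements lie above
level `ℓ m` and these new ones below it, so `shiftInterval` can tell them apart. -/
theorem IsRep.code_removal (h : IsRep P k ℓ r) (hmax : r m = k)
    (hlow : ∀ x, r x = k → ℓ m ≤ ℓ x) (hg : Function.Injective g)
    (hm : ∀ p, p ≠ m ↔ ∃ q, g q = p)
    (hlt : ∀ a b, a < b ↔ g a < g b ∧ g a ∉ uncovered m) :
    IsFree Q ∧ code P = addTop (ℓ m) (code Q) ∧ ℓ m ≤ levelBound (code Q) := by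
  have hcode := h.code_eq.trans (map_univ_eq_cons hg hm fun x => (ℓ x, r x))
  simp only [h.mem_uncovered, h.lt_iff] at hlt
  have hgm : ∀ q, g q ≠ m := fun q => (hm _).2 ⟨q, rfl⟩
  have hmk := h.left_le_top m
  by_cases halone : ∀ w, ℓ w = ℓ m → w = m
  · have hℓ : ∀ q, ℓ (g q) ≠ ℓ m := fun q hq => hgm q (halone _ hq)
    rcases hmk.eq_or_lt with hmk | hmk
    · have hr : ∀ q, r (g q) < k := fun q => lt_of_le_of_ne (h.le_top _) fun hq => by
        have := hlow _ hq
        exact hℓ q (le_antisymm ((h.left_le_top _).trans hmk.ge) this)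
      rcases Nat.eq_zero_or_pos k with hk | hk
      · have hQ : IsEmpty Q := ⟨fun q => by have := hr q; omega⟩
        refine ⟨⟨fun f => hQ.false (f (Sum.inl 0))⟩, ?_, by omega⟩
        rw [hcode, code_eq_zero, hmax, hmk, hk]
        simp [addTop, topIndex_zero]
      · have hrep : IsRep Q (k - 1) (fun q => ℓ (g q)) (fun q => r (g q)) := by
          refine ⟨fun a b => ?_, fun a => ?_, fun j hj => ?_, fun j hj => ?_⟩
          · rw [hlt]
            simp [hmk]
          · have := hr a
            omega
          · obtain ⟨x, hx⟩ := h.exists_left j (by omega)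
            obtain ⟨q, rfl⟩ := (hm x).1 (by rintro rfl; omega)
            exact ⟨q, hx⟩
          · obtain ⟨x, hx⟩ := h.exists_right j (by omega)
            obtain ⟨q, rfl⟩ := (hm x).1 (by rintro rfl; omega)
            exact ⟨q, hx⟩
        have hC := hrep.isCode
        have hlt' : lowTop (code Q) < ℓ m := by
          have := hC.lowTop_le_topIndex
          omega
        refine ⟨hrep.isFree, ?_, ?_⟩
        · rw [hC.addTop_of_lt hlt', hcode, hrep.code_eq, Multiset.map_map, hmax,
            Nat.sub_add_cancel hk]
          congr 1
          refine Multiset.map_congr rfl fun q _ => ?_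
          have := hr q
          have := h.left_le_right (g q)
          simp only [Function.comp_apply, shiftInterval]
          grind
        · rw [levelBound, if_neg hC.ne_zero, hC.topIndex_eq]
          omega
    · have hrep : IsRep Q (k - 1)
          (fun q => if ℓ m < ℓ (g q) then ℓ (g q) - 1 else ℓ (g q))
          (fun q => if r (g q) = ℓ m then k - 1 else
            if ℓ m < r (g q) then r (g q) - 1 else r (g q)) := by
        refine ⟨fun a b => ?_, fun a => ?_, fun j hj => ?_, fun j hj => ?_⟩
        · rw [hlt]
          have := hℓ b
          have := h.left_le_top (g b)
          grind
        · have := h.le_top (g a)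
          grind
        · rcases lt_or_ge j (ℓ m) with hjm | hjm
          · obtain ⟨x, hx⟩ := h.exists_left j (by omega)
            obtain ⟨q, rfl⟩ := (hm x).1 (by rintro rfl; omega)
            exact ⟨q, by grind⟩
          · obtain ⟨x, hx⟩ := h.exists_left (j + 1) (by omega)
            obtain ⟨q, rfl⟩ := (hm x).1 (by rintro rfl; omega)
            exact ⟨q, by grind⟩
        · rcases lt_or_ge j (ℓ m) with hjm | hjm
          · obtain ⟨x, hx⟩ := h.exists_right j (by omega)
            obtain ⟨q, rfl⟩ := (hm x).1 (by rintro rfl; omega)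
            exact ⟨q, by grind⟩
          · rcases hj.eq_or_lt with hjk | hjk
            · obtain ⟨x, hx⟩ := h.exists_left k le_rfl
              obtain ⟨q, rfl⟩ := (hm x).1 (by rintro rfl; omega)
              have := h.left_le_right (g q)
              have := h.le_top (g q)
              exact ⟨q, by grind⟩
            · obtain ⟨x, hx⟩ := h.exists_right (j + 1) (by omega)
              obtain ⟨q, rfl⟩ := (hm x).1 (by rintro rfl; omega)
              exact ⟨q, by grind⟩
      have hC := hrep.isCode
      -- An element with right end `ℓ m` has a smaller left end, since `m` is alone on its level,
      -- and it is maximal in `Q`.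
      have hlt' : lowTop (code Q) < ℓ m := by
        obtain ⟨x, hx⟩ := h.exists_right (ℓ m) hmk.le
        obtain ⟨q, rfl⟩ := (hm x).1 (by rintro rfl; omega)
        have h1 := h.left_le_right (g q)
        have h2 := hℓ q
        have : (ℓ (g q), k - 1) ∈ code Q := hrep.mem_code.2 ⟨q, by grind⟩
        have := hC.lowTop_le this
        omega
      refine ⟨hrep.isFree, ?_, ?_⟩
      · rw [hC.addTop_of_lt hlt', hcode, hrep.code_eq, Multiset.map_map, hmax,
          Nat.sub_add_cancel (by omega)]
        congr 1
        refine Multiset.map_congr rfl fun q _ => ?_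
        have h1 := h.left_le_right (g q)
        have h2 := h.le_top (g q)
        have h3 := hℓ q
        have h4 := hlow (g q)
        simp only [Function.comp_apply, shiftInterval]
        grind
      · rw [levelBound, if_neg hC.ne_zero, hC.topIndex_eq]
        omega
  · have hne : ∃ q, ℓ (g q) = ℓ m := by
      push Not at halone
      obtain ⟨w, hw, hwm⟩ := halone
      obtain ⟨q, rfl⟩ := (hm w).1 hwm
      exact ⟨q, hw⟩
    have hleft : ∀ j ≤ k, ∃ q, ℓ (g q) = j := fun j hj => by
      obtain ⟨x, rfl⟩ := h.exists_left j hj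
      by_cases hx : x = m
      · rwa [hx]
      · obtain ⟨q, rfl⟩ := (hm x).1 hx
        exact ⟨q, rfl⟩
    have hrep : IsRep Q k (fun q => ℓ (g q)) (fun q => r (g q)) := by
      refine ⟨fun a b => ?_, fun a => h.le_top _, hleft, fun j hj => ?_⟩
      · rw [hlt]
        simp [halone]
      · rcases hj.eq_or_lt with rfl | hj
        · obtain ⟨q, hq⟩ := hleft j le_rfl
          exact ⟨q, le_antisymm (h.le_top _) (hq.ge.trans (h.left_le_right _))⟩
        · obtain ⟨x, hx⟩ := h.exists_right j hj.le
          obtain ⟨q, rfl⟩ := (hm x).1 (by rintro rfl; omega)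
          exact ⟨q, hx⟩
    have hC := hrep.isCode
    have hle : ℓ m ≤ lowTop (code Q) := by
      obtain ⟨q, hq⟩ := hrep.mem_code.1 hC.lowTop_mem
      rw [Prod.mk.injEq] at hq
      rw [← hq.1]
      exact hlow _ hq.2
    refine ⟨hrep.isFree, ?_, ?_⟩
    · rw [hC.addTop_of_le hle, hcode, hrep.code_eq, hmax]
    · rw [levelBound, if_neg hC.ne_zero, hC.topIndex_eq]
      omega

end Removal

theorem Removal.code_eq {P Q : FinPartOrd.{0}} (hPQ : Removal P Q) (h : IsFree P) :
    IsFree Q ∧ code P = addTop (minmax P) (code Q) ∧ minmax P ≤ levelBound (code Q) := by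
  obtain ⟨m, hmax, hlevel, e, he⟩ := hPQ
  have : Nonempty P := ⟨m⟩
  rw [← hlevel]
  refine h.isRep.code_removal ((h.isRep.isMax_iff m).1 hmax) (fun x hx => ?_)
    (Subtype.val_injective.comp e.injective) (fun p => ⟨fun hp => ⟨e.symm ⟨p, hp⟩, by simp⟩, ?_⟩)
    he
  · rw [hlevel]
    exact Nat.sInf_le ⟨x, (h.isRep.isMax_iff x).2 hx, rfl⟩
  · rintro ⟨q, rfl⟩
    exact (e q).2

/-! ### Ascent sequences and interval multisets -/

/-- The largest letter that can be appended to the ascent sequence `w`. -/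
def letterBound (w : List ℕ) : ℕ := if w = [] then 0 else 1 + asc w

theorem asc_cons_cons (a b : ℕ) (l : List ℕ) :
    asc (a :: b :: l) = asc (b :: l) + if a < b then 1 else 0 := by
  simp [asc, List.countP_cons]

theorem asc_concat {w : List ℕ} (hw : w ≠ []) (i : ℕ) :
    asc (w ++ [i]) = asc w + if w.getLastD 0 < i then 1 else 0 := by
  induction w with
  | nil => exact absurd rfl hw
  | cons a l ih =>
    cases l with
    | nil => simp [asc, List.countP_cons]
    | cons b l =>
      have := ih (by simp)
      simp only [List.cons_append] at this ⊢
      rw [asc_cons_cons, asc_cons_cons, this]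
      simp only [List.getLastD_cons]
      ring

theorem getLastD_concat (w : List ℕ) (i : ℕ) : (w ++ [i]).getLastD 0 = i := by
  simp

theorem isAscentSeq_nil : IsAscentSeq [] := fun i h => absurd h (by simp)

theorem isAscentSeq_concat {w : List ℕ} {i : ℕ} :
    IsAscentSeq (w ++ [i]) ↔ IsAscentSeq w ∧ i ≤ letterBound w := by
  constructor
  · intro h
    refine ⟨fun j hj => ?_, ?_⟩
    · have := h j (by simp; omega)
      rwa [List.getElem_append_left hj, List.take_append_of_le_length hj.le] at this
    · have := h w.length (by simp)
      simpa [letterBound, List.length_eq_zero_iff] using this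
  · rintro ⟨h, hi⟩ j hj
    rcases Nat.lt_or_ge j w.length with hjw | hjw
    · rw [List.getElem_append_left hjw, List.take_append_of_le_length hjw.le]
      exact h j hjw
    · obtain rfl : j = w.length := by simp at hj; omega
      simpa [letterBound, List.length_eq_zero_iff] using hi

theorem IsAscentSeq.of_append {v l : List ℕ} (h : IsAscentSeq (v ++ l)) : IsAscentSeq v := by
  induction l using List.reverseRecOn with
  | nil => simpa using h
  | append_singleton l i ih =>
    rw [← List.append_assoc] at h
    exact ih (isAscentSeq_concat.1 h).1

theorem IsAscentSeq.asc_concat {w : List ℕ} {i : ℕ} (h : IsAscentSeq (w ++ [i])) :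
    asc (w ++ [i]) = asc w + if w.getLastD 0 < i then 1 else 0 := by
  by_cases hw : w = []
  · subst hw
    obtain rfl : i = 0 := by simpa [letterBound] using (isAscentSeq_concat.1 h).2
    simp [asc]
  · exact TwoPlusTwo.asc_concat hw i

theorem IsAscentSeq.asc_eq_zero_iff {w : List ℕ} (h : IsAscentSeq w) :
    asc w = 0 ↔ ∀ a ∈ w, a = 0 := by
  induction w using List.reverseRecOn with
  | nil => simp [asc]
  | append_singleton w i ih =>
    have ih := ih (isAscentSeq_concat.1 h).1
    rw [h.asc_concat, Nat.add_eq_zero_iff, ih]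
    have hlast : (∀ a ∈ w, a = 0) → w.getLastD 0 = 0 := fun hw => by
      rcases w.eq_nil_or_concat' with rfl | ⟨v, b, rfl⟩
      · rfl
      · simpa using hw b (by simp)
    simp only [List.mem_append, List.mem_singleton, or_imp, forall_and, forall_eq]
    refine and_congr_right fun hw => ?_
    rw [hlast hw]
    simp [Nat.pos_iff_ne_zero]

/-- The interval multiset of the poset that corresponds to an ascent sequence. -/
def seqCode (w : List ℕ) : Multiset (ℕ × ℕ) := w.foldl (fun s i => addTop i s) 0

theorem seqCode_concat (w : List ℕ) (i : ℕ) : seqCode (w ++ [i]) = addTop i (seqCode w) := by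
  simp [seqCode]

theorem card_seqCode (w : List ℕ) : Multiset.card (seqCode w) = w.length := by
  induction w using List.reverseRecOn with
  | nil => rfl
  | append_singleton w i ih => simp [seqCode_concat, card_addTop, ih]

theorem seqCode_eq_zero_iff {w : List ℕ} : seqCode w = 0 ↔ w = [] := by
  rw [← Multiset.card_eq_zero, card_seqCode, List.length_eq_zero_iff]

theorem countP_seqCode (w : List ℕ) : (seqCode w).countP (fun p => p.1 = 0) = w.count 0 := by
  induction w using List.reverseRecOn with
  | nil => rfl
  | append_singleton w i ih =>
    rw [seqCode_concat, countP_addTop, ih, List.count_append, List.count_singleton]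
    simp

/-- `addTop` raises the top index exactly when the new letter exceeds `lowTop`, which is the
previous letter; so levels count ascents and the two bounds agree. -/
theorem IsAscentSeq.seqCode_spec {w : List ℕ} (h : IsAscentSeq w) :
    IsCodeOrZero (seqCode w) ∧ topIndex (seqCode w) = asc w ∧
      lowTop (seqCode w) = w.getLastD 0 ∧ levelBound (seqCode w) = letterBound w := by
  have hbound : ∀ w, topIndex (seqCode w) = asc w → levelBound (seqCode w) = letterBound w := by
    intro w hw
    simp only [levelBound, letterBound, seqCode_eq_zero_iff, hw, add_comm]
  induction w using List.reverseRecOn with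
  | nil => exact ⟨Or.inl rfl, rfl, lowTop_zero, hbound _ rfl⟩
  | append_singleton w i ih =>
    obtain ⟨hw, hi⟩ := isAscentSeq_concat.1 h
    obtain ⟨h1, h2, h3, h4⟩ := ih hw
    rw [← h4] at hi
    have htop : topIndex (seqCode (w ++ [i])) = asc (w ++ [i]) := by
      rw [seqCode_concat, h1.topIndex_addTop hi, h.asc_concat, h2, h3]
      split_ifs <;> omega
    refine ⟨Or.inr ?_, htop, ?_, hbound (w ++ [i]) htop⟩
    · rw [seqCode_concat]
      exact ⟨_, h1.exists_isCode_addTop hi⟩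
    · rw [seqCode_concat, h1.lowTop_addTop hi, getLastD_concat]

theorem injOn_seqCode : Set.InjOn seqCode {w | IsAscentSeq w} := by
  intro w hw v hv heq
  change IsAscentSeq w at hw
  change IsAscentSeq v at hv
  have hlen : w.length = v.length := by rw [← card_seqCode, heq, card_seqCode]
  induction w using List.reverseRecOn generalizing v with
  | nil => exact (List.length_eq_zero_iff.1 hlen.symm).symm
  | append_singleton w i ih =>
    rcases v.eq_nil_or_concat' with rfl | ⟨v, j, rfl⟩
    · simp at hlen
    obtain ⟨hw, hi⟩ := isAscentSeq_concat.1 hw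
    obtain ⟨hv', hj⟩ := isAscentSeq_concat.1 hv
    rw [seqCode_concat, seqCode_concat] at heq
    have hsw := hw.seqCode_spec
    have hsv := hv'.seqCode_spec
    obtain ⟨rfl, h⟩ := hsw.1.addTop_injective hsv.1 (hi.trans hsw.2.2.2.ge)
      (hj.trans hsv.2.2.2.ge) heq
    rw [ih h hw hv' (by simpa using hlen)]

theorem IsFree.exists_seqCode_eq {P : FinPartOrd.{0}} (h : IsFree P) :
    ∃ w, IsAscentSeq w ∧ seqCode w = code P := by
  obtain ⟨n, hn⟩ : ∃ n, Multiset.card (code P) = n := ⟨_, rfl⟩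
  induction n generalizing P with
  | zero => exact ⟨[], isAscentSeq_nil, (Multiset.card_eq_zero.1 hn).symm⟩
  | succ n ih =>
    have : Nonempty P := by
      by_contra hP
      rw [not_nonempty_iff] at hP
      rw [code_eq_zero] at hn
      simp at hn
    obtain ⟨Q, hQ⟩ := exists_removal P
    obtain ⟨hfree, hcode, hle⟩ := hQ.code_eq h
    rw [hcode, card_addTop, Nat.add_right_cancel_iff] at hn
    obtain ⟨w, hw, hwQ⟩ := ih hfree hn
    refine ⟨w ++ [minmax P], isAscentSeq_concat.2 ⟨hw, ?_⟩, ?_⟩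
    · rwa [← hw.seqCode_spec.2.2.2, hwQ]
    · rw [seqCode_concat, hwQ, hcode]

/-! ### The statistic `lds` -/

theorem IsFree.isAntichainPoset_iff {P : Type*} [PartialOrder P] [Finite P] (h : IsFree P) :
    IsAntichainPoset P ↔ levels P = 0 := by
  cases isEmpty_or_nonempty P
  · rw [levels, downSets, Set.range_eq_empty, Set.ncard_empty]
    exact ⟨fun _ => rfl, fun _ x => isEmptyElim x⟩
  · constructor
    · intro hP
      by_contra hk
      obtain ⟨x, hx⟩ := h.isRep.exists_right 0 (Nat.zero_le _)
      obtain ⟨y, hy⟩ := h.isRep.exists_left 1 (by omega)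
      have hxy : x < y := (h.lt_iff x y).2 (by omega)
      exact hP trivial trivial hxy.ne hxy.le
    · intro hk x _ y _ hne hxy
      have := (h.lt_iff x y).1 (lt_of_le_of_ne hxy hne)
      have := h.isRep.left_le_top y
      omega

/-- By injectivity of `addTop`, a removal deletes the last letter whichever admissible `m` is
chosen. -/
theorem Removal.seqCode_eq {P Q : FinPartOrd.{0}} (hPQ : Removal P Q) (h : IsFree P)
    {w : List ℕ} {i : ℕ} (hw : IsAscentSeq (w ++ [i])) (hP : code P = seqCode (w ++ [i])) :
    IsFree Q ∧ code Q = seqCode w := by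
  obtain ⟨hQ, hcode, hle⟩ := hPQ.code_eq h
  obtain ⟨hw, hi⟩ := isAscentSeq_concat.1 hw
  rw [hP, seqCode_concat] at hcode
  have hs := hw.seqCode_spec
  exact ⟨hQ, (hs.1.addTop_injective hQ.isCodeOrZero (hi.trans hs.2.2.2.ge) hle hcode).2.symm⟩

theorem exists_prefix_of_reflTransGen {P Q : FinPartOrd.{0}}
    (hPQ : Relation.ReflTransGen Removal P Q) (h : IsFree P) {w : List ℕ} (hw : IsAscentSeq w)
    (hP : code P = seqCode w) :
    ∃ v, v <+: w ∧ IsAscentSeq v ∧ IsFree Q ∧ code Q = seqCode v := by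
  induction hPQ using Relation.ReflTransGen.head_induction_on generalizing w with
  | refl => exact ⟨w, List.prefix_rfl, hw, h, hP⟩
  | @head P R hPR _ ih =>
    rcases w.eq_nil_or_concat' with rfl | ⟨v, i, rfl⟩
    · obtain ⟨m, -⟩ := hPR
      have : Multiset.card (code P) = 0 := by rw [hP, card_seqCode, List.length_nil]
      rw [card_code, Nat.card_eq_zero] at this
      rcases this with hP | hP
      · exact hP.elim m
      · exact absurd (inferInstanceAs (Finite P)) (not_finite_iff_infinite.2 hP)
    · obtain ⟨hR, hcode⟩ := hPR.seqCode_eq h hw hP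
      obtain ⟨v', hv', hrest⟩ := ih hR (isAscentSeq_concat.1 hw).1 hcode
      exact ⟨v', hv'.trans (List.prefix_append _ _), hrest⟩

theorem exists_reflTransGen_of_append {P : FinPartOrd.{0}} (h : IsFree P) {v l : List ℕ}
    (hw : IsAscentSeq (v ++ l)) (hP : code P = seqCode (v ++ l)) :
    ∃ Q, Relation.ReflTransGen Removal P Q ∧ IsFree Q ∧ code Q = seqCode v := by
  induction l using List.reverseRecOn generalizing P with
  | nil => exact ⟨P, .refl, h, by simpa using hP⟩
  | append_singleton l i ih =>
    rw [← List.append_assoc] at hw hP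
    have : Nonempty P := by
      by_contra hempty
      rw [not_nonempty_iff] at hempty
      rw [code_eq_zero, eq_comm, seqCode_eq_zero_iff] at hP
      simp at hP
    obtain ⟨R, hR⟩ := exists_removal P
    obtain ⟨hfree, hcode⟩ := hR.seqCode_eq h hw hP
    obtain ⟨Q, hQ, hrest⟩ := ih hfree (isAscentSeq_concat.1 hw).1 hcode
    exact ⟨Q, .head hR hQ, hrest⟩

theorem IsFree.isAntichainPoset_iff_of_code {P : FinPartOrd.{0}} (h : IsFree P) {w : List ℕ}
    (hw : IsAscentSeq w) (hP : code P = seqCode w) : IsAntichainPoset P ↔ ∀ a ∈ w, a = 0 := by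
  rw [h.isAntichainPoset_iff, ← h.topIndex_code, hP, hw.seqCode_spec.2.1, hw.asc_eq_zero_iff]

/-- The posets reached are those of the prefixes of `w`, and a prefix gives an antichain iff it has
no non-zero letter; the longest such prefix is the initial run of zeros. -/
theorem IsFree.lds_eq_run {P : FinPartOrd.{0}} (h : IsFree P) {w : List ℕ} (hw : IsAscentSeq w)
    (hP : code P = seqCode w) : lds P = run w := by
  rw [lds, run]
  simp only [h.isAntichainPoset_iff_of_code hw hP]
  split_ifs with hzero
  · rfl
  refine IsGreatest.csSup_eq ⟨?_, ?_⟩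
  · have hsplit := List.takeWhile_append_dropWhile (p := (· = 0)) (l := w)
    obtain ⟨Q, hPQ, hQ, hcode⟩ := exists_reflTransGen_of_append (v := w.takeWhile (· = 0))
      (l := w.dropWhile (· = 0)) h (by rwa [hsplit]) (by rwa [hsplit])
    refine ⟨Q, hPQ, ?_, by rw [← card_code, hcode, card_seqCode]⟩
    refine (hQ.isAntichainPoset_iff_of_code ?_ hcode).2 fun a ha => ?_
    · rw [← hsplit] at hw
      exact hw.of_append
    · simpa using List.mem_takeWhile_imp ha
  · rintro _ ⟨Q, hPQ, hQ, rfl⟩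
    obtain ⟨v, ⟨l, rfl⟩, hv, hfree, hcode⟩ := exists_prefix_of_reflTransGen hPQ h hw hP
    rw [hfree.isAntichainPoset_iff_of_code hv hcode] at hQ
    rw [← card_code, hcode, card_seqCode,
      List.takeWhile_append_of_pos (fun a ha => by simpa using hQ a ha)]
    simp

theorem ascentGF_eq_posetGF : ascentGF = posetGF := by
  funext d
  rw [ascentGF, posetGF, Nat.cast_inj]
  refine Set.ncard_congr (fun w hw => Quotient.mk isoSetoid
    (Classical.choose hw.1.seqCode_spec.1.exists_poset)) ?_ ?_ ?_
  · intro w hw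
    have hP := Classical.choose_spec hw.1.seqCode_spec.1.exists_poset
    generalize Classical.choose hw.1.seqCode_spec.1.exists_poset = P at hP
    obtain ⟨h, hcode⟩ := hP
    obtain ⟨hasc, h0, h1, h2, h3, h4⟩ := hw
    obtain ⟨-, htop, hlow, -⟩ := hasc.seqCode_spec
    refine ⟨P, ⟨h, ?_, ?_, ?_, ?_, ?_⟩, rfl⟩
    · rw [← card_code, hcode, card_seqCode, h0]
    · rw [← h.topIndex_code, hcode, htop, h1]
    · rw [← h.lowTop_code, hcode, hlow, h2]
    · rw [← h.countP_code, hcode, countP_seqCode, h3]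
    · rw [h.lds_eq_run hasc hcode, h4]
  · intro w v hw hv heq
    have hP := Classical.choose_spec hw.1.seqCode_spec.1.exists_poset
    have hQ := Classical.choose_spec hv.1.seqCode_spec.1.exists_poset
    obtain ⟨e⟩ := Quotient.exact heq
    exact injOn_seqCode hw.1 hv.1 (hP.2.symm.trans ((hP.1.code_congr e).trans hQ.2))
  · rintro _ ⟨P, ⟨h, h0, h1, h2, h3, h4⟩, rfl⟩
    obtain ⟨w, hasc, hcode⟩ := h.exists_seqCode_eq
    obtain ⟨-, htop, hlow, -⟩ := hasc.seqCode_spec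
    have hw : IsAscentSeq w ∧ w.length = d 0 ∧ asc w = d 1 ∧ w.getLastD 0 = d 2 ∧
        w.count 0 = d 3 ∧ run w = d 4 := by
      refine ⟨hasc, ?_, ?_, ?_, ?_, ?_⟩
      · rw [← card_seqCode, hcode, card_code, h0]
      · rw [← htop, hcode, h.topIndex_code, h1]
      · rw [← hlow, hcode, h.lowTop_code, h2]
      · rw [← countP_seqCode, hcode, h.countP_code, h3]
      · rw [← h.lds_eq_run hasc hcode.symm, h4]
    refine ⟨w, hw, Quotient.sound ?_⟩
    have hQ := Classical.choose_spec hasc.seqCode_spec.1.exists_poset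
    exact nonempty_orderIso_of_code_eq hQ.1 h (hQ.2.trans hcode)

/-! ### The generating function of ascent sequences with a non-zero letter -/

/-- The ascent sequences of length `n` with a non-zero letter. -/
def mixedSeqs : ℕ → Finset (List ℕ)
  | 0 => ∅
  | n + 1 =>
    ((mixedSeqs n).biUnion fun w => (Finset.range (asc w + 2)).image fun i => w ++ [i]) ∪
      if n = 0 then ∅ else {List.replicate n 0 ++ [1]}

theorem isAscentSeq_replicate (n : ℕ) : IsAscentSeq (List.replicate n 0) :=
  fun i h => by simp

theorem asc_replicate (n : ℕ) : asc (List.replicate n 0) = 0 :=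
  (isAscentSeq_replicate n).asc_eq_zero_iff.2 fun _ ha => List.eq_of_mem_replicate ha

theorem getLastD_replicate (n : ℕ) : (List.replicate n 0).getLastD 0 = 0 := by
  cases n with
  | zero => rfl
  | succ n => rw [List.replicate_succ', getLastD_concat]

/-- A word of zeros has no ascents, so the only non-zero letter that can follow it is `1`, and only
if it is non-empty. -/
theorem mem_mixedSeqs {n : ℕ} {w : List ℕ} :
    w ∈ mixedSeqs n ↔ IsAscentSeq w ∧ w.length = n ∧ ∃ a ∈ w, a ≠ 0 := by
  induction n generalizing w with
  | zero =>
    simp only [mixedSeqs, Finset.notMem_empty, false_iff, List.length_eq_zero_iff]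
    rintro ⟨-, rfl, a, ha, -⟩
    simp at ha
  | succ n ih =>
    rw [mixedSeqs, Finset.mem_union, Finset.mem_biUnion]
    constructor
    · rintro (⟨v, hv, hw⟩ | hw)
      · obtain ⟨i, hi, rfl⟩ := Finset.mem_image.1 hw
        obtain ⟨hv, hlen, a, ha, ha0⟩ := ih.1 hv
        refine ⟨isAscentSeq_concat.2 ⟨hv, ?_⟩, by simp [hlen], a, by simp [ha], ha0⟩
        rw [letterBound, if_neg (List.ne_nil_of_mem ha)]
        have := Finset.mem_range.1 hi
        omega
      · split_ifs at hw with hn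
        · simp at hw
        · obtain rfl := Finset.mem_singleton.1 hw
          refine ⟨isAscentSeq_concat.2 ⟨isAscentSeq_replicate n, ?_⟩, by simp, 1, by simp, by simp⟩
          simp [letterBound, hn]
    · rintro ⟨hw, hlen, a, ha, ha0⟩
      rcases w.eq_nil_or_concat' with rfl | ⟨v, i, rfl⟩
      · simp at hlen
      obtain ⟨hv, hi⟩ := isAscentSeq_concat.1 hw
      have hlen : v.length = n := by simpa using hlen
      by_cases hmixed : ∃ a ∈ v, a ≠ 0
      · refine Or.inl ⟨v, ih.2 ⟨hv, hlen, hmixed⟩, Finset.mem_image.2 ⟨i, ?_, rfl⟩⟩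
        obtain ⟨b, hb, -⟩ := hmixed
        rw [letterBound, if_neg (List.ne_nil_of_mem hb)] at hi
        rw [Finset.mem_range]
        omega
      · push Not at hmixed
        have hv0 : v = List.replicate n 0 := List.eq_replicate_iff.2 ⟨hlen, hmixed⟩
        subst hv0
        have hi0 : i ≠ 0 := by
          rintro rfl
          rcases List.mem_append.1 ha with h | h
          · exact ha0 (hmixed a h)
          · exact ha0 (List.mem_singleton.1 h)
        have hn : n ≠ 0 := by
          rintro rfl
          simp [letterBound] at hi
          exact hi0 hi
        simp only [letterBound, List.replicate_eq_nil_iff, hn, if_false, asc_replicate] at hi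
        obtain rfl : i = 1 := by omega
        simp [hn]

theorem IsAscentSeq.getLastD_le_asc {w : List ℕ} (h : IsAscentSeq w) : w.getLastD 0 ≤ asc w := by
  obtain ⟨hs, htop, hlow, -⟩ := h.seqCode_spec
  rw [← hlow, ← htop]
  rcases hs with hs | ⟨k, hs⟩
  · rw [hs, lowTop_zero]
    exact Nat.zero_le _
  · exact hs.lowTop_le_topIndex.trans hs.topIndex_eq.ge

/-- The run is frozen once a non-zero letter has occurred; this is why all-zero words are treated
separately. -/
theorem run_concat {w : List ℕ} (hw : ∃ a ∈ w, a ≠ 0) (i : ℕ) : run (w ++ [i]) = run w := by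
  obtain ⟨a, ha, ha0⟩ := hw
  rw [run, run, if_neg fun h => ha0 (h a (by simp [ha])), if_neg fun h => ha0 (h a ha),
    List.takeWhile_append, if_neg]
  intro hlen
  have hpre : w.takeWhile (· = 0) <+: w := ⟨_, List.takeWhile_append_dropWhile⟩
  have := List.takeWhile_eq_self_iff.1 (hpre.eq_of_length hlen) a ha
  simp [ha0] at this

theorem run_replicate_concat (n : ℕ) : run (List.replicate n 0 ++ [1]) = n := by
  rw [run, if_neg fun h => absurd (h 1 (by simp)) one_ne_zero,
    List.takeWhile_append_of_pos (by simp)]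
  simp

/-! ### Recursion on the last letter -/

section Weight

variable {R : Type*} [CommRing R]

/-- The monomial of a sequence, without the variable that marks its length. -/
def weight (u v z x : R) (w : List ℕ) : R :=
  u ^ asc w * v ^ w.getLastD 0 * z ^ w.count 0 * x ^ run w

/-- The sum of the monomials of the ascent sequences of length `n` with a non-zero letter. -/
def mixedSum (u v z x : R) (n : ℕ) : R := ∑ w ∈ mixedSeqs n, weight u v z x w

/-- Two geometric sums, over letters up to `l` and over the ascents beyond `l`, with a correction by
`z` for the letter `0`. The factor `v - 1` avoids division. -/
theorem sub_one_mul_sum_letters (u v z : R) {l N : ℕ} (h : l + 1 ≤ N) :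
    (v - 1) * ∑ i ∈ Finset.range N, (u ^ (if l < i then 1 else 0) * v ^ i *
        z ^ (if i = 0 then 1 else 0)) =
      (z - 1) * (v - 1) + (v ^ (l + 1) - 1) + u * (v ^ N - v ^ (l + 1)) := by
  induction N, h using Nat.le_induction with
  | base =>
    have : ∀ j ≤ l, (v - 1) * ∑ i ∈ Finset.range (j + 1), (u ^ (if l < i then 1 else 0) * v ^ i *
        z ^ (if i = 0 then 1 else 0)) = (z - 1) * (v - 1) + (v ^ (j + 1) - 1) := by
      intro j hj
      induction j with
      | zero =>
        simp
        ring
      | succ j ih =>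
        rw [Finset.sum_range_succ, mul_add, ih (by omega), if_neg (by omega),
          if_neg (Nat.succ_ne_zero j)]
        ring
    rw [this l le_rfl]
    ring
  | succ N hN ih =>
    rw [Finset.sum_range_succ, mul_add, ih, if_pos (by omega), if_neg (by omega)]
    ring

/-- The sum over letters with `l` the last letter and `N = asc w + 2`: the power `v ^ N` joins `u ^
asc w` to `(u * v) ^ asc w`, which produces the argument `u * v`. -/
theorem sub_one_mul_sum_weight (u v z x : R) {w : List ℕ} (hw : IsAscentSeq w)
    (hmixed : ∃ a ∈ w, a ≠ 0) :
    (v - 1) * ∑ i ∈ Finset.range (asc w + 2), weight u v z x (w ++ [i]) =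
      (z * (v - 1) - v) * weight u 1 z x w + v * (1 - u) * weight u v z x w +
        u * v ^ 2 * weight (u * v) 1 z x w := by
  have hne : w ≠ [] := by
    rintro rfl
    simp at hmixed
  have hterm : ∀ i, weight u v z x (w ++ [i]) = (u ^ asc w * z ^ w.count 0 * x ^ run w) *
      (u ^ (if w.getLastD 0 < i then 1 else 0) * v ^ i * z ^ (if i = 0 then 1 else 0)) := by
    intro i
    rw [weight, asc_concat hne, getLastD_concat, run_concat hmixed, List.count_append,
      List.count_singleton, pow_add, pow_add]
    simp only [beq_iff_eq]
    ring
  simp only [hterm]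
  have hle := hw.getLastD_le_asc
  rw [← Finset.mul_sum, mul_left_comm, sub_one_mul_sum_letters u v z (by omega)]
  simp only [weight]
  ring

theorem sub_one_mul_mixedSum_succ (u v z x : R) (n : ℕ) :
    (v - 1) * mixedSum u v z x (n + 1) =
      (v - 1) * (u * v * if n = 0 then 0 else (z * x) ^ n) +
        ((z * (v - 1) - v) * mixedSum u 1 z x n + v * (1 - u) * mixedSum u v z x n +
          u * v ^ 2 * mixedSum (u * v) 1 z x n) := by
  have hdisj : Disjoint
      ((mixedSeqs n).biUnion fun w => (Finset.range (asc w + 2)).image fun i => w ++ [i])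
      (if n = 0 then ∅ else {List.replicate n 0 ++ [1]}) := by
    split_ifs with hn
    · simp
    · rw [Finset.disjoint_singleton_right, Finset.mem_biUnion]
      rintro ⟨w, hw, hmem⟩
      obtain ⟨i, -, hi⟩ := Finset.mem_image.1 hmem
      obtain ⟨rfl, -⟩ := List.append_inj' hi rfl
      obtain ⟨-, -, a, ha, ha0⟩ := mem_mixedSeqs.1 hw
      exact ha0 (List.eq_of_mem_replicate ha)
  have hpair : ((mixedSeqs n : Finset (List ℕ)) : Set (List ℕ)).PairwiseDisjoint
      fun w => (Finset.range (asc w + 2)).image fun i => w ++ [i] := by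
    intro w _ w' _ hne
    rw [Function.onFun, Finset.disjoint_left]
    rintro _ hv hv'
    obtain ⟨i, -, rfl⟩ := Finset.mem_image.1 hv
    obtain ⟨j, -, hj⟩ := Finset.mem_image.1 hv'
    exact hne (List.append_inj' hj rfl).1.symm
  rw [mixedSum, mixedSeqs, Finset.sum_union hdisj, Finset.sum_biUnion hpair, mul_add, add_comm]
  congr 1
  · congr 1
    split_ifs with hn
    · simp
    · rw [Finset.sum_singleton, weight, run_replicate_concat, getLastD_concat,
        asc_concat (by simpa), asc_replicate]
      rw [getLastD_replicate]
      simp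
      ring
  · simp only [mixedSum, Finset.mul_sum, ← Finset.sum_add_distrib]
    refine Finset.sum_congr rfl fun w hw => ?_
    obtain ⟨hasc, -, hmixed⟩ := mem_mixedSeqs.1 hw
    rw [Finset.sum_image fun i _ j _ hij => by simpa using hij, ← Finset.mul_sum]
    exact sub_one_mul_sum_weight u v z x hasc hmixed

end Weight

/-! ### The functional equation and its solution -/

theorem delta_one {R : Type*} [CommRing R] (t u : R) : delta t u 1 = 1 + t * (u - 1) := by
  rw [delta]
  ring

open MvPowerSeries in
theorem summable_of_X_pow_dvd {σ : Type*} (i : σ) {f : ℕ → MvPowerSeries σ ℤ}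
    (h : ∀ n, X i ^ n ∣ f n) : Summable f := by
  rw [WithPiTopology.summable_iff_summable_coeff]
  intro d
  refine summable_of_ne_finset_zero (s := Finset.range (d i + 1)) fun n hn => ?_
  exact X_pow_dvd_iff.1 (h n) d (by simpa using hn)

section Solution

open MvPowerSeries

local notation "𝔸" => MvPowerSeries (Fin 5) ℤ

local notation "𝕥" => (X 0 : MvPowerSeries (Fin 5) ℤ)

/-- The generating function of the ascent sequences with a non-zero letter; the length is marked
by the first variable of the power series ring. -/
def mixedGF (u v z x : 𝔸) : 𝔸 := ∑' n, 𝕥 ^ n * mixedSum u v z x n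

theorem summable_mixed (u v z x : 𝔸) : Summable fun n => 𝕥 ^ n * mixedSum u v z x n :=
  summable_of_X_pow_dvd 0 fun _ => dvd_mul_right _ _

/-- The generating function of the sequences `0, …, 0, 1`. -/
def startGF (z x : 𝔸) : 𝔸 := ∑' n, 𝕥 ^ (n + 1) * if n = 0 then 0 else (z * x) ^ n

theorem summable_start (z x : 𝔸) :
    Summable fun n => 𝕥 ^ (n + 1) * if n = 0 then 0 else (z * x) ^ n :=
  summable_of_X_pow_dvd 0 fun n => (pow_dvd_pow _ n.le_succ).trans (dvd_mul_right _ _)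

theorem one_sub_mul_startGF (z x : 𝔸) : (1 - 𝕥 * z * x) * startGF z x = 𝕥 ^ 2 * z * x := by
  have h0 : constantCoeff (𝕥 * z * x) = 0 := by simp
  have hstart : startGF z x = 𝕥 ^ 2 * z * x * ∑' n : ℕ, (𝕥 * z * x) ^ n := by
    rw [startGF, (summable_start z x).tsum_eq_zero_add,
      ← (WithPiTopology.summable_pow_of_constantCoeff_eq_zero h0).tsum_mul_left]
    simp only [if_true, mul_zero, zero_add]
    refine tsum_congr fun n => ?_
    rw [if_neg (Nat.succ_ne_zero n)]
    ring
  rw [hstart, mul_left_comm, WithPiTopology.one_sub_mul_tsum_pow_of_constantCoeff_eq_zero h0,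
    mul_one]

/-- Sum the recursion over lengths and move the `mixedGF u v z x` term to the left: `v - 1 - t v (1
- u) = v δ_1 - 1`. The arguments are arbitrary power series, so later substitutions are mere
instances. -/
theorem mixedGF_functional (u v z x : 𝔸) :
    (v * delta 𝕥 u 1 - 1) * mixedGF u v z x =
      (v - 1) * (u * v) * startGF z x + 𝕥 * (z * (v - 1) - v) * mixedGF u 1 z x +
        𝕥 * (u * v ^ 2) * mixedGF (u * v) 1 z x := by
  have hsucc : (v - 1) * mixedGF u v z x =
      ∑' n, 𝕥 ^ (n + 1) * ((v - 1) * mixedSum u v z x (n + 1)) := by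
    have h0 : mixedSum u v z x 0 = 0 := by simp [mixedSum, mixedSeqs]
    rw [mixedGF, (summable_mixed u v z x).tsum_eq_zero_add, h0, mul_zero, zero_add,
      ← ((summable_nat_add_iff 1).2 (summable_mixed u v z x)).tsum_mul_left]
    exact tsum_congr fun n => mul_left_comm _ _ _
  have h1 := (summable_start z x).hasSum.mul_left ((v - 1) * (u * v))
  have h2 := (summable_mixed u 1 z x).hasSum.mul_left (𝕥 * (z * (v - 1) - v))
  have h3 := (summable_mixed u v z x).hasSum.mul_left (𝕥 * (v * (1 - u)))
  have h4 := (summable_mixed (u * v) 1 z x).hasSum.mul_left (𝕥 * (u * v ^ 2))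
  have hsum := ((h1.add h2).add (h3.add h4)).tsum_eq
  rw [← startGF, ← mixedGF, ← mixedGF, ← mixedGF] at hsum
  have hcongr : (v - 1) * mixedGF u v z x = (v - 1) * (u * v) * startGF z x +
      𝕥 * (z * (v - 1) - v) * mixedGF u 1 z x + (𝕥 * (v * (1 - u)) * mixedGF u v z x +
      𝕥 * (u * v ^ 2) * mixedGF (u * v) 1 z x) := by
    rw [hsucc, ← hsum]
    refine tsum_congr fun n => ?_
    rw [sub_one_mul_mixedSum_succ]
    ring
  rw [delta_one]
  linear_combination hcongr

/-- Kernel method: at `v = w = 1/δ_1` the left side of the functional equation vanishes. Since `w -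
1 = t (1 - u) w`, a common factor `t` can be cancelled. -/
theorem mixedGF_kernel {u w : 𝔸} (z x : 𝔸) (hw : w * delta 𝕥 u 1 = 1) :
    (1 + z * 𝕥 * (u - 1)) * mixedGF u 1 z x =
      u * w * mixedGF (u * w) 1 z x + (1 - u) * u * w * startGF z x := by
  have h := mixedGF_functional u w z x
  rw [hw, sub_self, zero_mul] at h
  have hX : (𝕥 : 𝔸) ≠ 0 := fun h0 => by
    have := congrArg (coeff (Finsupp.single 0 1)) h0
    rw [coeff_index_single_self_X, map_zero] at this
    exact one_ne_zero this
  apply mul_left_cancel₀ hX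
  rw [delta_one] at hw
  linear_combination (1 + 𝕥 * (u - 1)) * h + (u * w * startGF z x +
    𝕥 * (z - 1) * mixedGF u 1 z x + 𝕥 * u * w * mixedGF (u * w) 1 z x) * hw

theorem isUnit_of_constantCoeff_eq_one {a : 𝔸} (h : constantCoeff a = 1) : IsUnit a :=
  isUnit_iff_constantCoeff.2 (by rw [h]; exact isUnit_one)

theorem isUnit_delta (u : 𝔸) (k : ℕ) : IsUnit (delta 𝕥 u k) :=
  isUnit_of_constantCoeff_eq_one (by simp [delta])

theorem isUnit_gamma (u z : 𝔸) (k : ℕ) : IsUnit (gamma 𝕥 u z k) := by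
  refine isUnit_of_constantCoeff_eq_one ?_
  unfold gamma
  split_ifs <;> simp

theorem isUnit_prod_gamma (u z : 𝔸) (k : ℕ) : IsUnit (∏ i ∈ Finset.Icc 1 k, gamma 𝕥 u z i) :=
  Finset.prod_induction _ IsUnit (fun _ _ => IsUnit.mul) isUnit_one fun i _ => isUnit_gamma u z i

theorem isUnit_denom (u z : 𝔸) (s : ℕ) : IsUnit (denom 𝕥 u z s) :=
  ((isUnit_delta u s).mul (isUnit_delta u (s + 1))).mul (isUnit_prod_gamma u z (s + 1))

/-- Apply the kernel identity at `u/δ_N`. From `δ_N(u) δ_1(u/δ_N) = δ_{N+1}(u)` the next argument is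
`u/δ_{N+1}`, and the coefficient on the left becomes `γ_{N+1}/δ_N`. -/
theorem mixedGF_iterate (u z x : 𝔸) (N : ℕ) :
    mixedGF u 1 z x = ∑ s ∈ Finset.range N, startGF z x * u * (1 - u) * term 𝕥 u z s +
      u ^ N * Ring.inverse (delta 𝕥 u N) * Ring.inverse (∏ i ∈ Finset.Icc 1 N, gamma 𝕥 u z i) *
        mixedGF (u * Ring.inverse (delta 𝕥 u N)) 1 z x := by
  induction N with
  | zero => simp [delta]
  | succ N ih =>
    have hD := Ring.mul_inverse_cancel _ (isUnit_delta u N)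
    have hD' := Ring.mul_inverse_cancel _ (isUnit_delta u (N + 1))
    have hG := Ring.mul_inverse_cancel _ (isUnit_gamma u z (N + 1))
    have hterm : term 𝕥 u z N = u ^ N * (1 - 𝕥) ^ N * (Ring.inverse (delta 𝕥 u N) *
        Ring.inverse (delta 𝕥 u (N + 1)) * (Ring.inverse (∏ i ∈ Finset.Icc 1 N, gamma 𝕥 u z i) *
          Ring.inverse (gamma 𝕥 u z (N + 1)))) := by
      rw [term, denom, Finset.prod_Icc_succ_top (by omega), Ring.mul_inverse_rev,
        Ring.mul_inverse_rev, Ring.mul_inverse_rev]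
      ring
    have hw : delta 𝕥 u N * Ring.inverse (delta 𝕥 u (N + 1)) *
        delta 𝕥 (u * Ring.inverse (delta 𝕥 u N)) 1 = 1 := by
      have : delta 𝕥 u N * delta 𝕥 (u * Ring.inverse (delta 𝕥 u N)) 1 = delta 𝕥 u (N + 1) := by
        have : delta 𝕥 u (N + 1) = delta 𝕥 u N + 𝕥 * (u - delta 𝕥 u N) := by
          simp only [delta]
          ring
        rw [this, delta_one]
        linear_combination 𝕥 * u * hD
      linear_combination Ring.inverse (delta 𝕥 u (N + 1)) * this + hD'
    have hkernel := mixedGF_kernel z x hw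
    have harg : u * Ring.inverse (delta 𝕥 u N) *
        (delta 𝕥 u N * Ring.inverse (delta 𝕥 u (N + 1))) =
          u * Ring.inverse (delta 𝕥 u (N + 1)) := by
      linear_combination u * Ring.inverse (delta 𝕥 u (N + 1)) * hD
    rw [harg] at hkernel
    have hγ : gamma 𝕥 u z (N + 1) = delta 𝕥 u N + z * 𝕥 * (u - delta 𝕥 u N) := by
      rw [gamma, if_neg (Nat.succ_ne_zero N), Nat.add_sub_cancel, delta]
      ring
    -- The source of the factor `(1 - t)^s` in the summand.
    have hδ : delta 𝕥 u N - u = (1 - 𝕥) ^ N * (1 - u) := by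
      rw [delta]
      ring
    rw [Finset.sum_range_succ, Finset.prod_Icc_succ_top (by omega), Ring.mul_inverse_rev, ih,
      hterm, add_assoc]
    congr 1
    generalize mixedGF (u * Ring.inverse (delta 𝕥 u N)) 1 z x = K at *
    generalize mixedGF (u * Ring.inverse (delta 𝕥 u (N + 1))) 1 z x = K' at *
    generalize startGF z x = C at *
    generalize Ring.inverse (∏ i ∈ Finset.Icc 1 N, gamma 𝕥 u z i) = p
    generalize Ring.inverse (gamma 𝕥 u z (N + 1)) = g at *
    generalize gamma 𝕥 u z (N + 1) = γ at *
    generalize Ring.inverse (delta 𝕥 u N) = D at *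
    generalize Ring.inverse (delta 𝕥 u (N + 1)) = D' at *
    generalize delta 𝕥 u N = d at *
    have hstep : γ * D * K = u * D' * K' + (d - u) * D * D' * u * C := by
      linear_combination hkernel + ((1 - z * 𝕥) * K - u ^ 2 * D * D' * C) * hD + D * K * hγ
    rw [hδ] at hstep
    linear_combination -(u ^ N * D * p * K) * hG + u ^ N * p * g * hstep

theorem summable_term {u : 𝔸} (hu : X 1 ∣ u) (z : 𝔸) : Summable fun s => term 𝕥 u z s :=
  summable_of_X_pow_dvd 1 fun s =>
    (pow_dvd_pow_of_dvd hu s).trans ((dvd_mul_right _ _).trans (dvd_mul_right _ _))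

/-- The remainder after `N` iterations is divisible by `X 1 ^ N`, hence tends to `0`. The hypothesis
covers both `u` and `u * v`. -/
theorem mixedGF_one_eq {u : 𝔸} (hu : X 1 ∣ u) (z x : 𝔸) :
    mixedGF u 1 z x = startGF z x * u * (1 - u) * ∑' s, term 𝕥 u z s := by
  rw [← (summable_term hu z).tsum_mul_left]
  have hsum := ((summable_term hu z).mul_left
    (startGF z x * u * (1 - u))).hasSum.tendsto_sum_nat
  have hrest : Filter.Tendsto (fun N => u ^ N * Ring.inverse (delta 𝕥 u N) *
      Ring.inverse (∏ i ∈ Finset.Icc 1 N, gamma 𝕥 u z i) *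
        mixedGF (u * Ring.inverse (delta 𝕥 u N)) 1 z x) Filter.atTop (nhds 0) := by
    refine Summable.tendsto_atTop_zero (summable_of_X_pow_dvd 1 fun N => ?_)
    exact (pow_dvd_pow_of_dvd hu N).trans
      (((dvd_mul_right _ _).trans (dvd_mul_right _ _)).trans (dvd_mul_right _ _))
  have := hsum.add hrest
  simp only [← mixedGF_iterate, add_zero] at this
  exact tendsto_nhds_unique tendsto_const_nhds this

/-! ### From coefficients to the closed form -/

theorem coeff_X_pow_mul_weight (d : Fin 5 →₀ ℕ) (w : List ℕ) :
    coeff d (𝕥 ^ w.length * weight (X 1) (X 2) (X 3) (X 4) w) =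
      if w.length = d 0 ∧ asc w = d 1 ∧ w.getLastD 0 = d 2 ∧ w.count 0 = d 3 ∧ run w = d 4
      then 1 else 0 := by
  classical
  simp only [weight, X_pow_eq, monomial_mul_monomial, mul_one, coeff_monomial]
  refine if_congr ?_ rfl rfl
  rw [Finsupp.ext_iff, Fin.forall_fin_succ, Fin.forall_fin_succ, Fin.forall_fin_succ,
    Fin.forall_fin_succ, Fin.forall_fin_succ]
  simp [Finsupp.single_apply, eq_comm]

/-- The all-zero word has `run` equal to `0` by convention, so it contributes `(t z)^n` without a
power of `x`. -/
theorem sum_weight_eq (n : ℕ) :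
    ∑ w ∈ insert (List.replicate n 0) (mixedSeqs n),
        𝕥 ^ w.length * weight (X 1) (X 2) (X 3) (X 4) w =
      (𝕥 * X 3) ^ n + 𝕥 ^ n * mixedSum (X 1) (X 2) (X 3) (X 4) n := by
  have hnot : List.replicate n 0 ∉ mixedSeqs n := fun h => by
    obtain ⟨-, -, a, ha, ha0⟩ := mem_mixedSeqs.1 h
    exact ha0 (List.eq_of_mem_replicate ha)
  have hrun : run (List.replicate n 0) = 0 := if_pos fun a ha => List.eq_of_mem_replicate ha
  rw [Finset.sum_insert hnot, mixedSum, Finset.mul_sum]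
  congr 1
  · rw [weight, asc_replicate, getLastD_replicate, hrun]
    simp [mul_pow]
  · exact Finset.sum_congr rfl fun w hw => by rw [(mem_mixedSeqs.1 hw).2.1]

theorem mem_insert_mixedSeqs {n : ℕ} {w : List ℕ} :
    w ∈ insert (List.replicate n 0) (mixedSeqs n) ↔ IsAscentSeq w ∧ w.length = n := by
  rw [Finset.mem_insert, mem_mixedSeqs]
  constructor
  · rintro (rfl | h)
    · exact ⟨isAscentSeq_replicate n, List.length_replicate⟩
    · exact ⟨h.1, h.2.1⟩
  · rintro ⟨h, hlen⟩
    by_cases hw : ∀ a ∈ w, a = 0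
    · exact Or.inl (List.eq_replicate_iff.2 ⟨hlen, hw⟩)
    · push Not at hw
      exact Or.inr ⟨h, hlen, hw⟩

theorem hasSum_ascentGF :
    HasSum (fun n => (𝕥 * X 3) ^ n + 𝕥 ^ n * mixedSum (X 1) (X 2) (X 3) (X 4) n) ascentGF := by
  rw [WithPiTopology.hasSum_iff_hasSum_coeff]
  intro d
  simp only [← sum_weight_eq, map_sum, coeff_X_pow_mul_weight]
  convert hasSum_single (d 0) ?_ using 1
  · rw [Finset.sum_boole]
    change ((Set.ncard _ : ℕ) : ℤ) = _
    rw [← Set.ncard_coe_finset]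
    congr 2
    ext w
    simp only [Finset.coe_filter, Set.mem_ofPred_eq, mem_insert_mixedSeqs]
    tauto
  · intro n hn
    refine Finset.sum_eq_zero fun w hw => if_neg fun h => hn ?_
    rw [← h.1, (mem_insert_mixedSeqs.1 hw).2]

theorem ascentGF_eq_add_mixedGF :
    ascentGF = Ring.inverse (1 - 𝕥 * X 3) + mixedGF (X 1) (X 2) (X 3) (X 4) := by
  have h0 : constantCoeff (𝕥 * X 3) = 0 := by simp
  have hgeom := WithPiTopology.summable_pow_of_constantCoeff_eq_zero h0
  rw [← hasSum_ascentGF.tsum_eq, hgeom.tsum_add (summable_mixed _ _ _ _), ← mixedGF]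
  congr 1
  rw [← mul_one (Ring.inverse (1 - 𝕥 * X 3)), eq_comm,
    Ring.inverse_mul_eq_iff_eq_mul _ _ _ (isUnit_of_constantCoeff_eq_one (by simp))]
  exact (WithPiTopology.one_sub_mul_tsum_pow_of_constantCoeff_eq_zero h0).symm

end Solution

end TwoPlusTwo

end

/-- Identity in `ℤ⟦t, u, v, z, x⟧`, with `ℤ` discrete and the topology of coefficientwise
convergence; all denominators are units and both series converge. -/
theorem theorem3p2 (t u v z x : MvPowerSeries (Fin 5) ℤ)
    (ht : t = MvPowerSeries.X 0) (hu : u = MvPowerSeries.X 1) (hv : v = MvPowerSeries.X 2)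
    (hz : z = MvPowerSeries.X 3) (hx : x = MvPowerSeries.X 4) :
    IsUnit (1 - t * z) ∧
    IsUnit ((1 - t * z * x) * (v * TwoPlusTwo.delta t u 1 - 1)) ∧
    (∀ s : ℕ, IsUnit (TwoPlusTwo.denom t u z s) ∧ IsUnit (TwoPlusTwo.denom t (u * v) z s)) ∧
    Summable (fun s : ℕ => TwoPlusTwo.term t u z s) ∧
    Summable (fun s : ℕ => TwoPlusTwo.term t (u * v) z s) ∧
    TwoPlusTwo.posetGF =
      Ring.inverse (1 - t * z) +
        t ^ 2 * z * x * u *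
            Ring.inverse ((1 - t * z * x) * (v * TwoPlusTwo.delta t u 1 - 1)) *
          (v * (v - 1)
            + t * (1 - u) * (z * (v - 1) - v) * (∑' s : ℕ, TwoPlusTwo.term t u z s)
            + u * v ^ 3 * t * (1 - u * v) * (∑' s : ℕ, TwoPlusTwo.term t (u * v) z s)) ∧
    TwoPlusTwo.ascentGF = TwoPlusTwo.posetGF := by
  subst ht hu hv hz hx
  have hunit : IsUnit ((1 - MvPowerSeries.X 0 * MvPowerSeries.X 3 * MvPowerSeries.X 4) *
      (MvPowerSeries.X 2 * TwoPlusTwo.delta (MvPowerSeries.X 0) (MvPowerSeries.X 1) 1 - 1 :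
        MvPowerSeries (Fin 5) ℤ)) :=
    -- The constant coefficient is `-1`.
    MvPowerSeries.isUnit_iff_constantCoeff.2 (by simp)
  have hu : (MvPowerSeries.X 1 : MvPowerSeries (Fin 5) ℤ) ∣ MvPowerSeries.X 1 := dvd_rfl
  have huv : (MvPowerSeries.X 1 : MvPowerSeries (Fin 5) ℤ) ∣
      MvPowerSeries.X 1 * MvPowerSeries.X 2 := dvd_mul_right _ _
  refine ⟨TwoPlusTwo.isUnit_of_constantCoeff_eq_one (by simp), hunit,
    fun s => ⟨TwoPlusTwo.isUnit_denom _ _ s, TwoPlusTwo.isUnit_denom _ _ s⟩,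
    TwoPlusTwo.summable_term hu _, TwoPlusTwo.summable_term huv _, ?_,
    TwoPlusTwo.ascentGF_eq_posetGF⟩
  rw [← TwoPlusTwo.ascentGF_eq_posetGF, TwoPlusTwo.ascentGF_eq_add_mixedGF, mul_right_comm]
  congr 1
  rw [Ring.eq_mul_inverse_iff_mul_eq _ _ _ hunit]
  have hfun := TwoPlusTwo.mixedGF_functional (MvPowerSeries.X 1) (MvPowerSeries.X 2)
    (MvPowerSeries.X 3) (MvPowerSeries.X 4)
  rw [TwoPlusTwo.mixedGF_one_eq hu, TwoPlusTwo.mixedGF_one_eq huv] at hfun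
  have hstart := TwoPlusTwo.one_sub_mul_startGF (MvPowerSeries.X 3) (MvPowerSeries.X 4)
  -- Multiply the functional equation by `1 - tzx`; every term on its right then contains `(1 - tzx)
  -- * startGF`, which is `t² z x`.
  linear_combination (1 - MvPowerSeries.X 0 * MvPowerSeries.X 3 * MvPowerSeries.X 4) * hfun +
    MvPowerSeries.X 1 * (MvPowerSeries.X 2 * (MvPowerSeries.X 2 - 1) +
      MvPowerSeries.X 0 * (1 - MvPowerSeries.X 1) *
        (MvPowerSeries.X 3 * (MvPowerSeries.X 2 - 1) - MvPowerSeries.X 2) *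
        (∑' s, TwoPlusTwo.term (MvPowerSeries.X 0) (MvPowerSeries.X 1) (MvPowerSeries.X 3) s) +
      MvPowerSeries.X 1 * MvPowerSeries.X 2 ^ 3 * MvPowerSeries.X 0 *
        (1 - MvPowerSeries.X 1 * MvPowerSeries.X 2) *
        (∑' s, TwoPlusTwo.term (MvPowerSeries.X 0) (MvPowerSeries.X 1 * MvPowerSeries.X 2)
          (MvPowerSeries.X 3) s)) * hstart
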